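/- Let $\mathcal F^2(\mathbb C^d)$ be the Fock space of all entire functions $f$ on $\mathbb C^d$ with $\|f\|^2=\pi^{-d}\int_{\mathbb C^d}|f(z)|^2e^{-|z|^2}\,dV(z)<\infty$, where $dV$ is Lebesgue measure, and let $\langle u,v\rangle=\sum_i u_i\overline{v_i}$ on $\mathbb C^d$. For a nonzero entire function $\psi$ on $\mathbb C^d$ and a holomorphic map $\varphi:\mathbb C^d\to\mathbb C^d$, a weighted composition operator $C_{\psi,\varphi}$ is an operator on $\mathcal F^2(\mathbb C^d)$ whose domain is a linear subspace of $\{f\in\mathcal F^2(\mathbb C^d):\psi\cdot(f\circ\varphi)\in\mathcal F^2(\mathbb C^d)\}$ and which acts by $C_{\psi,\varphi}f=\psi\cdot(f\circ\varphi)$. For a $d\times d$ complex matrix $A$, $b\in\mathbb C^d$ and $c\in\mathbb C$ put $$\mathcal C_{A,b,c}f(z)=c\,e^{\langle z,\overline b\rangle}\,\overline{f\big(\overline{Az+b}\big)}.$$ A conjugation is an antilinear, involutive and isometric map $\mathcal C$ of $\mathcal F^2(\mathbb C^d)$ to itself. A closed densely defined operator $S$ is $\mathcal C$-selfadjoint if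 $S=\mathcal C S^*\mathcal C$, equality of domains included. **Proposition.** Suppose that $C_{\psi,\varphi}$ is everywhere defined on $\mathcal F^2(\mathbb C^d)$, bounded and normal. Then $C_{\psi,\varphi}$ is $\mathcal C_{A,b,c}$-selfadjoint for some conjugation $\mathcal C_{A,b,c}$, and one can take $b=0$, $c=1$ and $A$ as follows. The map $\varphi$ has the form $\varphi(z)=Qz+q$ with a $d\times d$ matrix $Q$ and $q\in\mathbb C^d$, and there are a unitary matrix $V$ and $\mu_1,\dots,\mu_d\in\mathbb C$ with $Q=V\,\mathrm{diag}(\mu_1,\dots,\mu_d)\,V^*$ such that, for every $i$, $$(1-\overline{\mu_i})\,(V^*q)_i\in\mathbb R\ \text{ if }\mu_i\neq1,\qquad (V^*q)_i\in i\mathbb R\ \text{ if }\mu_i=1 .$$ For every such $V$ and $(\mu_i)$, with $A=\overline V\,V^*$, the operator $\mathcal C_{A,0,1}$ is a conjugation on $\mathcal F^2(\mathbb C^d)$ and $C_{\psi,\varphi}$ is $\mathcal C_{A,0,1}$-selfadjoint. -/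

import Mathlib

noncomputable section

/-! ## The Fock space -/

/-- The `d`-dimensional complex Euclidean space. -/
abbrev CSpace (d : ℕ) : Type := EuclideanSpace ℂ (Fin d)

/-- The Gaussian measure `π⁻ᵈ e^{-|z|²} dV(z)` on `ℂᵈ`, where `dV` is the Lebesgue measure. -/
def gaussMeasure (d : ℕ) : MeasureTheory.Measure (CSpace d) :=
  MeasureTheory.volume.withDensity
    (fun z => ENNReal.ofReal ((Real.pi ^ d)⁻¹ * Real.exp (-‖z‖ ^ 2)))

instance (d : ℕ) : MeasureTheory.IsProbabilityMeasure (gaussMeasure d) where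
  measure_univ := by
    have h1 : ∫ z : CSpace d, Real.exp (-‖z‖ ^ 2) = Real.pi ^ d := by
      have := GaussianFourier.integral_rexp_neg_mul_sq_norm (V := CSpace d) (b := 1) (by norm_num)
      rw [← Module.finrank_mul_finrank ℝ ℂ] at this
      simpa using this
    have hint : MeasureTheory.Integrable (fun z : CSpace d => Real.exp (-‖z‖ ^ 2)) := by
      by_contra hn
      rw [MeasureTheory.integral_undef hn] at h1
      have : 0 < Real.pi ^ d := by positivity
      linarith
    rw [gaussMeasure, MeasureTheory.withDensity_apply _ MeasurableSet.univ,
      MeasureTheory.Measure.restrict_univ,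
      ← MeasureTheory.ofReal_integral_eq_lintegral_ofReal (hint.const_mul _)
        (Filter.Eventually.of_forall fun z => by positivity),
      MeasureTheory.integral_const_mul, h1, inv_mul_cancel₀ (by positivity), ENNReal.ofReal_one]

/-- The entire functions on `ℂᵈ` that are square integrable for the Gaussian measure. -/
def fockSubmodule (d : ℕ) : Submodule ℂ (CSpace d → ℂ) where
  carrier := {f | Differentiable ℂ f ∧ MeasureTheory.MemLp f 2 (gaussMeasure d)}
  add_mem' hf hg := ⟨hf.1.add hg.1, hf.2.add hg.2⟩
  zero_mem' := ⟨differentiable_const 0, MeasureTheory.MemLp.zero⟩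
  smul_mem' c _ hf := ⟨hf.1.const_smul c, hf.2.const_smul c⟩

/-- The Fock space of `ℂᵈ`. It is a separate type, so that it carries the norm topology and not
the topology of pointwise convergence of the space of all functions. -/
def FockSpace (d : ℕ) : Type := fockSubmodule d

namespace FockSpace

variable {d : ℕ}

instance : AddCommGroup (FockSpace d) := inferInstanceAs (AddCommGroup (fockSubmodule d))

instance : Module ℂ (FockSpace d) := inferInstanceAs (Module ℂ (fockSubmodule d))

/-- The inclusion of the Fock space into the space of all functions. -/
def toFunₗ (d : ℕ) : FockSpace d →ₗ[ℂ] (CSpace d → ℂ) := (fockSubmodule d).subtype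

instance : CoeFun (FockSpace d) (fun _ => CSpace d → ℂ) := ⟨fun f => toFunₗ d f⟩

theorem differentiable (f : FockSpace d) : Differentiable ℂ f := f.2.1

theorem memLp (f : FockSpace d) : MeasureTheory.MemLp f 2 (gaussMeasure d) := f.2.2

@[ext] theorem ext {f g : FockSpace d} (h : ∀ z, f z = g z) : f = g := Subtype.ext (funext h)

@[simp] theorem add_apply (f g : FockSpace d) (z : CSpace d) : (f + g) z = f z + g z := rfl

@[simp] theorem sub_apply (f g : FockSpace d) (z : CSpace d) : (f - g) z = f z - g z := rfl

@[simp] theorem smul_apply (c : ℂ) (f : FockSpace d) (z : CSpace d) : (c • f) z = c * f z := rfl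

@[simp] theorem zero_apply (z : CSpace d) : (0 : FockSpace d) z = 0 := rfl

theorem integrable_mul_conj (f g : FockSpace d) :
    MeasureTheory.Integrable (fun z => g z * (starRingEnd ℂ) (f z)) (gaussMeasure d) :=
  g.memLp.integrable_mul f.memLp.star

theorem eq_zero_of_ae (f : FockSpace d) (h : ∀ᵐ z ∂(gaussMeasure d), f z = 0) : f = 0 := by
  have hv : ∀ᵐ z ∂(MeasureTheory.volume : MeasureTheory.Measure (CSpace d)), f z = 0 := by
    rw [gaussMeasure, MeasureTheory.ae_withDensity_iff (by fun_prop)] at h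
    filter_upwards [h] with z hz
    exact hz (by simpa using (by positivity : 0 < (Real.pi ^ d)⁻¹ * Real.exp (-‖z‖ ^ 2)))
  have := f.differentiable.continuous.ae_eq_iff_eq (μ := MeasureTheory.volume)
    (continuous_const (y := (0 : ℂ)))
  exact ext fun z => congrFun (this.1 hv) z

/-- The inner product of the Fock space. The literature on this space takes it to be linear in the
first entry, `⟨f, g⟩ = π⁻ᵈ ∫ f ḡ e^{-|z|²} dV`; here, as everywhere in Mathlib, it is linear in the
second entry, so `inner ℂ g f` is what is usually written `⟨f, g⟩`. -/
@[reducible] def core (d : ℕ) : InnerProductSpace.Core ℂ (FockSpace d) where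
  inner f g := ∫ z, g z * (starRingEnd ℂ) (f z) ∂(gaussMeasure d)
  conj_inner_symm f g := by
    rw [← integral_conj]
    simp [mul_comm]
  re_inner_nonneg f := by
    have : ∀ z, f z * (starRingEnd ℂ) (f z) = ((‖f z‖ ^ 2 : ℝ) : ℂ) := fun z => by
      rw [Complex.mul_conj, Complex.normSq_eq_norm_sq]
    simp only [this, integral_complex_ofReal]
    exact MeasureTheory.integral_nonneg fun z => by positivity
  add_left f g h := by
    rw [← MeasureTheory.integral_add (integrable_mul_conj f h) (integrable_mul_conj g h)]
    simp [mul_add]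
  smul_left f g c := by
    rw [← MeasureTheory.integral_const_mul]
    congr 1
    ext z
    simp
    ring
  definite f h := by
    have : ∀ z, f z * (starRingEnd ℂ) (f z) = ((‖f z‖ ^ 2 : ℝ) : ℂ) := fun z => by
      rw [Complex.mul_conj, Complex.normSq_eq_norm_sq]
    simp only [this, integral_complex_ofReal] at h
    have h0 : ∫ z, ‖f z‖ ^ 2 ∂(gaussMeasure d) = 0 := by exact_mod_cast h
    rw [MeasureTheory.integral_eq_zero_iff_of_nonneg (fun z => by positivity)
      (f.memLp.integrable_norm_pow (by norm_num))] at h0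
    refine eq_zero_of_ae f ?_
    filter_upwards [h0] with z hz
    simpa using hz

instance : NormedAddCommGroup (FockSpace d) :=
  @InnerProductSpace.Core.toNormedAddCommGroup ℂ (FockSpace d) _ _ _ (core d)

instance : InnerProductSpace ℂ (FockSpace d) := InnerProductSpace.ofCore (core d).toCore

theorem inner_eq (f g : FockSpace d) :
    inner ℂ f g = ∫ z, g z * (starRingEnd ℂ) (f z) ∂(gaussMeasure d) := rfl

/-- The class of a function of the Fock space in `L²`. -/
def toL2 (d : ℕ) : FockSpace d →ₗᵢ[ℂ] MeasureTheory.Lp ℂ 2 (gaussMeasure d) :=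
  LinearMap.isometryOfInner
    { toFun := fun f => f.memLp.toLp f
      map_add' := fun _ _ => rfl
      map_smul' := fun _ _ => rfl }
    (fun f g => by
      rw [inner_eq, MeasureTheory.L2.inner_def]
      refine MeasureTheory.integral_congr_ae ?_
      filter_upwards [f.memLp.coeFn_toLp, g.memLp.coeFn_toLp] with z hf hg
      change inner ℂ (f.memLp.toLp f z) (g.memLp.toLp g z) = _
      rw [hf, hg]
      rfl)

/-! ### Completeness -/

theorem volume_ball_mul_eq {h : CSpace d → ℂ} (hh : Differentiable ℂ h) (z : CSpace d) :
    ((MeasureTheory.volume (Metric.ball (0 : CSpace d) 1)).toReal : ℂ) * h z =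
      ∫ w in Metric.ball (0 : CSpace d) 1, h (z + w) := by
  have hc := hh.continuous
  set B := Metric.ball (0 : CSpace d) 1
  have rot : ∀ θ : ℝ, ∫ w in B, h (z + circleMap 0 1 θ • w) = ∫ w in B, h (z + w) := by
    intro θ
    let e : CSpace d ≃ₗᵢ[ℂ] CSpace d :=
      LinearIsometryEquiv.mk (LinearEquiv.smulOfNeZero ℂ (CSpace d) (circleMap 0 1 θ)
        (circleMap_ne_center one_ne_zero)) (fun w => by simp [norm_smul])
    let e2 : CSpace d ≃ₗᵢ[ℝ] CSpace d :=
      LinearIsometryEquiv.mk (e.toLinearEquiv.restrictScalars ℝ) (fun w => e.norm_map w)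
    have he : ∀ w, e2 w = circleMap 0 1 θ • w := fun w => rfl
    have hpre : e2 ⁻¹' B = B := by
      ext w
      simp [B]
    have := e2.measurePreserving.setIntegral_preimage_emb
      e2.toHomeomorph.measurableEmbedding (fun w => h (z + w)) B
    rw [hpre] at this
    simpa only [he] using this
  have avg : ∀ w : CSpace d,
      ∫ θ in (0 : ℝ)..2 * Real.pi, h (z + circleMap 0 1 θ • w) = (2 * Real.pi : ℝ) • h z := by
    intro w
    have hd : Differentiable ℂ (fun t : ℂ => h (z + t • w)) := by fun_prop
    have := (hd.diffContOnCl (s := Metric.ball 0 |1|)).circleAverage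
    rw [Real.circleAverage_def, inv_smul_eq_iff₀ (by positivity)] at this
    simpa using this
  have swap := MeasureTheory.intervalIntegral_integral_swap (a := 0) (b := 2 * Real.pi)
    (μ := MeasureTheory.volume.restrict B)
    (f := fun (θ : ℝ) (w : CSpace d) => h (z + circleMap 0 1 θ • w)) (by
      have hcont : Continuous (fun p : ℝ × CSpace d => h (z + circleMap 0 1 p.1 • p.2)) := by
        fun_prop
      rw [MeasureTheory.Measure.prod_restrict]
      refine MeasureTheory.IntegrableOn.mono_set (hcont.continuousOn.integrableOn_compact
        ((isCompact_uIcc (a := 0) (b := 2 * Real.pi)).prod (isCompact_closedBall (0 : CSpace d) 1))) ?_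
      exact Set.prod_mono Set.uIoc_subset_uIcc Metric.ball_subset_closedBall)
  simp only [rot, avg] at swap
  rw [intervalIntegral.integral_const, MeasureTheory.setIntegral_const] at swap
  have hpi : (Real.pi : ℂ) ≠ 0 := by exact_mod_cast Real.pi_ne_zero
  simp only [Complex.real_smul, MeasureTheory.measureReal_def] at swap
  push_cast at swap
  have h2 : (2 * (Real.pi : ℂ)) ≠ 0 := by simp [hpi]
  refine mul_left_cancel₀ h2 ?_
  linear_combination -swap

theorem eLpNorm_eq (f : FockSpace d) :
    MeasureTheory.eLpNorm f 2 (gaussMeasure d) = ENNReal.ofReal ‖f‖ := by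
  have h1 : ‖f‖ = ‖f.memLp.toLp f‖ := ((toL2 d).norm_map f).symm
  rw [h1, MeasureTheory.Lp.norm_toLp, ENNReal.ofReal_toReal f.memLp.2.ne]

/-- Point evaluations are bounded, uniformly on bounded sets. -/
theorem exists_bound (d : ℕ) (R : ℝ) :
    ∃ C : ℝ, 0 ≤ C ∧ ∀ (f : FockSpace d) (z : CSpace d), ‖z‖ ≤ R → ‖f z‖ ≤ C * ‖f‖ := by
  set v : ℝ := (MeasureTheory.volume (Metric.ball (0 : CSpace d) 1)).toReal with hv
  have hvpos : 0 < v := ENNReal.toReal_pos (Metric.measure_ball_pos _ _ one_pos).ne'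
    MeasureTheory.measure_ball_lt_top.ne
  set K : ℝ := Real.pi ^ d * Real.exp ((R + 1) ^ 2) with hK
  refine ⟨v⁻¹ * K, by positivity, fun f z hz => ?_⟩
  have key : ENNReal.ofReal (v * ‖f z‖) ≤ ENNReal.ofReal (K * ‖f‖) := by
    calc ENNReal.ofReal (v * ‖f z‖) = ‖(v : ℂ) * f z‖ₑ := by
          rw [← ofReal_norm, norm_mul, Complex.norm_real, Real.norm_of_nonneg hvpos.le]
      _ = ‖∫ w in Metric.ball (0 : CSpace d) 1, f (z + w)‖ₑ := by
          rw [hv, volume_ball_mul_eq f.differentiable z]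
      _ ≤ ∫⁻ w in Metric.ball (0 : CSpace d) 1, ‖f (z + w)‖ₑ :=
          MeasureTheory.enorm_integral_le_lintegral_enorm _
      _ ≤ ∫⁻ w, ENNReal.ofReal K *
            (ENNReal.ofReal ((Real.pi ^ d)⁻¹ * Real.exp (-‖z + w‖ ^ 2)) * ‖f (z + w)‖ₑ) := by
          refine (MeasureTheory.setLIntegral_mono_ae' measurableSet_ball
            (Filter.Eventually.of_forall fun w hw => ?_)).trans
            (MeasureTheory.setLIntegral_le_lintegral _ _)
          rw [← mul_assoc, ← ENNReal.ofReal_mul (by positivity)]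
          refine le_mul_of_one_le_left zero_le (ENNReal.one_le_ofReal.2 ?_)
          have h1 : ‖z + w‖ ≤ R + 1 :=
            (norm_add_le z w).trans (add_le_add hz (mem_ball_zero_iff.1 hw).le)
          have h2 : ‖z + w‖ ^ 2 ≤ (R + 1) ^ 2 := pow_le_pow_left₀ (norm_nonneg _) h1 2
          have h3 : K * ((Real.pi ^ d)⁻¹ * Real.exp (-‖z + w‖ ^ 2)) =
              Real.exp ((R + 1) ^ 2 + -‖z + w‖ ^ 2) := by
            rw [hK, Real.exp_add]
            field_simp
          rw [h3]
          exact Real.one_le_exp (by linarith)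
      _ = ∫⁻ w, ENNReal.ofReal K *
            (ENNReal.ofReal ((Real.pi ^ d)⁻¹ * Real.exp (-‖w‖ ^ 2)) * ‖f w‖ₑ) :=
          MeasureTheory.lintegral_add_left_eq_self (fun w => ENNReal.ofReal K *
            (ENNReal.ofReal ((Real.pi ^ d)⁻¹ * Real.exp (-‖w‖ ^ 2)) * ‖f w‖ₑ)) z
      _ = ENNReal.ofReal K * MeasureTheory.eLpNorm f 1 (gaussMeasure d) := by
          have hfm : Measurable (f : CSpace d → ℂ) := f.differentiable.continuous.measurable
          rw [MeasureTheory.lintegral_const_mul _ (by fun_prop),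
            MeasureTheory.eLpNorm_one_eq_lintegral_enorm, gaussMeasure,
            MeasureTheory.lintegral_withDensity_eq_lintegral_mul _ (by fun_prop) (by fun_prop)]
          rfl
      _ ≤ ENNReal.ofReal K * MeasureTheory.eLpNorm f 2 (gaussMeasure d) := by
          gcongr
          exact MeasureTheory.eLpNorm_le_eLpNorm_of_exponent_le (by norm_num) f.memLp.1
      _ = ENNReal.ofReal (K * ‖f‖) := by
          rw [eLpNorm_eq, ENNReal.ofReal_mul (p := K) (by positivity)]
  have := (ENNReal.ofReal_le_ofReal_iff (by positivity)).1 key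
  rw [mul_assoc, inv_mul_eq_div, le_div_iff₀ hvpos]
  linarith

/-- The derivatives at the points of a bounded set are bounded as well. -/
theorem exists_bound_fderiv (d : ℕ) (R : ℝ) :
    ∃ C : ℝ, 0 ≤ C ∧ ∀ (f : FockSpace d) (z : CSpace d), ‖z‖ ≤ R →
      ‖fderiv ℂ f z‖ ≤ C * ‖f‖ := by
  obtain ⟨C, hC, h⟩ := exists_bound d (R + 1)
  refine ⟨2 * C, by positivity, fun f z hz => ?_⟩
  have hb : ∀ w ∈ Metric.closedBall z 1, ‖f w‖ ≤ C * ‖f‖ := fun w hw => by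
    refine h f w ?_
    have h1 : ‖w - z‖ ≤ 1 := mem_closedBall_iff_norm.1 hw
    have h2 := norm_add_le z (w - z)
    rw [add_sub_cancel] at h2
    linarith
  have := Complex.norm_fderiv_le_div_of_mapsTo_ball (f := f) (c := z) (R₁ := 1)
    (R₂ := 2 * C * ‖f‖) f.differentiable.differentiableOn (fun w hw => by
      rw [mem_closedBall_iff_norm]
      have h1 := hb w (Metric.ball_subset_closedBall hw)
      have h2 := hb z (Metric.mem_closedBall_self zero_le_one)
      have h3 := norm_sub_le (f w) (f z)
      linarith) one_pos
  simpa using this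

instance : CompleteSpace (FockSpace d) := by
  refine Metric.complete_of_cauchySeq_tendsto fun u hu => ?_
  have cauchy_of : ∀ {X : Type} [NormedAddCommGroup X] (T : ℕ → X) (C : ℝ), 0 ≤ C →
      (∀ m n, ‖T m - T n‖ ≤ C * ‖u m - u n‖) → CauchySeq T := by
    intro X _ T C hC hT
    rw [Metric.cauchySeq_iff] at hu ⊢
    intro ε hε
    obtain ⟨N, hN⟩ := hu (ε / (C + 1)) (by positivity)
    refine ⟨N, fun m hm n hn => ?_⟩
    have h1 := hN m hm n hn
    rw [dist_eq_norm, lt_div_iff₀ (by positivity)] at h1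
    rw [dist_eq_norm]
    have := hT m n
    nlinarith [norm_nonneg (u m - u n)]
  have hptw : ∀ z, ∃ a, Filter.Tendsto (fun n => u n z) Filter.atTop (nhds a) := fun z => by
    obtain ⟨C, hC, h⟩ := exists_bound d ‖z‖
    exact cauchySeq_tendsto_of_complete
      (cauchy_of (fun n => u n z) C hC fun m n => h (u m - u n) z le_rfl)
  have hfd : ∀ m n z, fderiv ℂ (u m) z - fderiv ℂ (u n) z =
      fderiv ℂ ((u m - u n : FockSpace d) : CSpace d → ℂ) z := fun m n z =>
    (fderiv_sub (u m).differentiable.differentiableAt (u n).differentiable.differentiableAt).symm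
  have hder : ∀ z, ∃ L, Filter.Tendsto (fun n => fderiv ℂ (u n) z) Filter.atTop (nhds L) :=
    fun z => by
      obtain ⟨C, hC, h⟩ := exists_bound_fderiv d ‖z‖
      exact cauchySeq_tendsto_of_complete
        (cauchy_of (fun n => fderiv ℂ (u n) z) C hC fun m n => by
          rw [hfd]
          exact h (u m - u n) z le_rfl)
  choose g hg using hptw
  choose L hL using hder
  have hdiff : Differentiable ℂ g := by
    intro z
    obtain ⟨C, hC, h⟩ := exists_bound_fderiv d (‖z‖ + 1)
    have hunif : TendstoUniformlyOn (fun n z => fderiv ℂ (u n) z) L Filter.atTop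
        (Metric.ball z 1) := by
      refine UniformCauchySeqOn.tendstoUniformlyOn_of_tendsto ?_ fun w _ => hL w
      rw [Metric.uniformCauchySeqOn_iff]
      intro ε hε
      obtain ⟨N, hN⟩ := Metric.cauchySeq_iff.1 hu (ε / (C + 1)) (by positivity)
      refine ⟨N, fun m hm n hn w hw => ?_⟩
      have h1 := hN m hm n hn
      rw [dist_eq_norm, lt_div_iff₀ (by positivity)] at h1
      rw [dist_eq_norm, hfd]
      have hw1 : ‖w - z‖ < 1 := mem_ball_iff_norm.1 hw
      have h2 := norm_add_le z (w - z)
      rw [add_sub_cancel] at h2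
      have := h (u m - u n) w (by linarith)
      nlinarith [norm_nonneg (u m - u n)]
    exact (hasFDerivAt_of_tendstoUniformlyOn Metric.isOpen_ball hunif
      (fun n w _ => ((u n).differentiable w).hasFDerivAt) (fun w _ => hg w)
      (Metric.mem_ball_self one_pos)).differentiableAt
  obtain ⟨G, hG⟩ := cauchySeq_tendsto_of_complete
    ((toL2 d).isometry.uniformContinuous.comp_cauchySeq hu)
  have hGg : ⇑G =ᵐ[gaussMeasure d] g := by
    obtain ⟨ns, hns, hae⟩ :=
      (MeasureTheory.tendstoInMeasure_of_tendsto_Lp hG).exists_seq_tendsto_ae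
    have hco : ∀ᵐ z ∂(gaussMeasure d), ∀ n, ((toL2 d (u n) : MeasureTheory.Lp ℂ 2 (gaussMeasure d)) : CSpace d → ℂ) z = u n z :=
     
      MeasureTheory.ae_all_iff.2 fun n => (u n).memLp.coeFn_toLp
    filter_upwards [hae, hco] with z h1 h2
    simp only [Function.comp_apply, h2] at h1
    exact tendsto_nhds_unique h1 ((hg z).comp hns.tendsto_atTop)
  have hmem : MeasureTheory.MemLp g 2 (gaussMeasure d) :=
    (MeasureTheory.memLp_congr_ae hGg).1 (MeasureTheory.Lp.memLp G)
  let f : FockSpace d := ⟨g, hdiff, hmem⟩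
  have hf : toL2 d f = G := by
    refine MeasureTheory.Lp.ext ?_
    exact (MeasureTheory.MemLp.coeFn_toLp f.memLp).trans hGg.symm
  refine ⟨f, ?_⟩
  rw [← hf] at hG
  exact (toL2 d).isometry.isEmbedding.tendsto_nhds_iff.2 hG

end FockSpace

/-! ## Conjugations and complex selfadjoint operators on a Hilbert space -/

section Hilbert

variable {H : Type*} [NormedAddCommGroup H] [InnerProductSpace ℂ H]

/-- A conjugation: an antilinear map that is involutive and isometric. -/
structure IsConjugation (J : H →ₛₗ[starRingEnd ℂ] H) : Prop where
  involutive : ∀ f, J (J f) = f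
  isometric : ∀ f, ‖J f‖ = ‖f‖

/-- The operator `J S J`, with its natural domain `{f | J f ∈ dom S}`. -/
def conjugateBy (J : H →ₛₗ[starRingEnd ℂ] H) (S : H →ₗ.[ℂ] H) : H →ₗ.[ℂ] H where
  domain := S.domain.comap J
  toFun :=
    { toFun := fun f => J (S ⟨J f, f.2⟩)
      map_add' := fun f g => by
        rw [← map_add J, ← S.map_add]
        congr 2
        ext
        simp
      map_smul' := fun c f => by
        have h : (⟨J ((c • f : S.domain.comap J) : H), (c • f).2⟩ : S.domain) =
            (starRingEnd ℂ) c • ⟨J f, f.2⟩ := by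
          ext
          simp
        rw [h, S.map_smul]
        simp }

/-- A closed densely defined operator `S` with `S = J S* J`, the domains included. -/
structure IsConjSelfadjoint [CompleteSpace H] (J : H →ₛₗ[starRingEnd ℂ] H) (S : H →ₗ.[ℂ] H) :
    Prop where
  isClosed : S.IsClosed
  dense : Dense (S.domain : Set H)
  eq : S = conjugateBy J S.adjoint

/-- The operator is everywhere defined, bounded, and normal. -/
def IsBoundedNormal [CompleteSpace H] (S : H →ₗ.[ℂ] H) : Prop :=
  ∃ B : H →L[ℂ] H, S = (B : H →ₗ[ℂ] H).toPMap ⊤ ∧ IsStarNormal B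

end Hilbert

/-! ## Weighted composition operators -/

/-- The weighted composition expression `f ↦ ψ · (f ∘ φ)` on all functions. -/
def weightedCompExpr {d : ℕ} (ψ : CSpace d → ℂ) (φ : CSpace d → CSpace d) :
    (CSpace d → ℂ) →ₗ[ℂ] (CSpace d → ℂ) where
  toFun f z := ψ z * f (φ z)
  map_add' f g := by
    ext z
    simp [mul_add]
  map_smul' c f := by
    ext z
    simp [mul_left_comm]

/-- The maximal weighted composition operator on the Fock space, whose domain consists of all `f`
in the Fock space such that `ψ · (f ∘ φ)` is in the Fock space again. -/
def maxWeightedComp {d : ℕ} (ψ : CSpace d → ℂ) (φ : CSpace d → CSpace d) :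
    FockSpace d →ₗ.[ℂ] FockSpace d where
  domain := (fockSubmodule d).comap (weightedCompExpr ψ φ ∘ₗ FockSpace.toFunₗ d)
  toFun :=
    { toFun := fun f => ⟨weightedCompExpr ψ φ (f : FockSpace d), f.2⟩
      map_add' := fun f g =>
        Subtype.ext ((weightedCompExpr ψ φ ∘ₗ FockSpace.toFunₗ d).map_add f g)
      map_smul' := fun c f =>
        Subtype.ext ((weightedCompExpr ψ φ ∘ₗ FockSpace.toFunₗ d).map_smul c f) }

/-- A weighted composition operator with symbols `ψ`, `φ` is a restriction of the maximal one. -/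
def IsWeightedComp {d : ℕ} (ψ : CSpace d → ℂ) (φ : CSpace d → CSpace d)
    (T : FockSpace d →ₗ.[ℂ] FockSpace d) : Prop :=
  T ≤ maxWeightedComp ψ φ

/-! ## The concrete conjugations -/

/-- The coordinatewise complex conjugate of a vector. -/
def conjVec {d : ℕ} (z : CSpace d) : CSpace d :=
  WithLp.toLp 2 (fun i => (starRingEnd ℂ) (z i))

/-- The function `z ↦ c e^{⟨z, b̄⟩} \overline{f(\overline{A z + b})}`; here `⟨u, v⟩ = ∑ uᵢ v̄ᵢ`,
which is `inner ℂ v u`. -/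
def conjExpr {d : ℕ} (A : Matrix (Fin d) (Fin d) ℂ) (b : CSpace d) (c : ℂ) (f : CSpace d → ℂ)
    (z : CSpace d) : ℂ :=
  c * Complex.exp (inner ℂ (conjVec b) z) *
    (starRingEnd ℂ) (f (conjVec (Matrix.toEuclideanLin A z + b)))

/-- `V` is unitary, `Q = V diag(μ) V*`, and the `i`-th entry of `V* q` becomes real when it is
multiplied by `1 - μ̄ᵢ` if `μᵢ ≠ 1`, and is purely imaginary if `μᵢ = 1`. -/
structure IsAdaptedDiagonalization {d : ℕ} (Q : Matrix (Fin d) (Fin d) ℂ) (q : CSpace d)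
    (V : Matrix (Fin d) (Fin d) ℂ) (μ : Fin d → ℂ) : Prop where
  unitary : V ∈ Matrix.unitaryGroup (Fin d) ℂ
  diag : Q = V * Matrix.diagonal μ * V.conjTranspose
  real : ∀ i, μ i ≠ 1 →
    ((1 - (starRingEnd ℂ) (μ i)) * Matrix.toEuclideanLin V.conjTranspose q i).im = 0
  imag : ∀ i, μ i = 1 → (Matrix.toEuclideanLin V.conjTranspose q i).re = 0

end

noncomputable section

/-! ## Gaussian integrals of entire functions -/

/-! Write `K_w` for the kernel `e^{⟨z, w⟩}` and `B` for the bounded operator. Since `B* K_w = conj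
(ψ w) K_{φ w}`, normality forbids zeros of `ψ`, and comparing norms bounds `|ψ z|² e^{|φ z|²}` by a
multiple of `e^{|z|²}`. Take logarithms and average over circles in complex lines: `log |ψ|`
averages to its value at `0`, so `|φ|²` grows at most quadratically in the mean. Hence `φ z = L z +
q` with `L` a contraction (`affine_of_weight_bound`).

If `1` is an eigenvalue of `L`, `φ` may have no fixed point. Instead `q = q₀ + (p - L p)` with `q₀`
fixed by `L` and `L*` (`exists_fixed_add_range`), so `φ` translates the line `p + ℂ q₀` by `q₀`.
Liouville's theorem on this line relates `ψ (p + q₀)` to `ψ p` (`weight_translate`) and puts the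
norms of `K_p`, `B* K_p`, `B*² K_p` in geometric progression. For a normal operator this is equality
in Cauchy–Schwarz, so `B B* K_p = c K_p`, which forces `ψ z = ψ 0 · e^{⟨z, s⟩}` with `s = p - L* p -
q₀`. Comparing `B B*` and `B* B` on all kernels gives `L* (L w + q) + s = L (L* w + s) + q`, so `L`
is normal and `L* q + s = L s + q` (`exists_symbols`).

In an adapted eigenbasis these relations say that the coordinates of `s` are the conjugates of those
of `q` (`eq_conj_of_adapted`). So the antiunitary involution `R z = V conj (V* z)` satisfies `R q =
s` and `R L = L* R`, and `J f = conj (f ∘ R)`, which is the conjugation with `A = conj V · V*`,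
intertwines `B` and `B*` (`apply_fockConj`). -/

open MeasureTheory in
theorem integral_gaussMeasure {d : ℕ} (g : CSpace d → ℂ) :
    ∫ z, g z ∂(gaussMeasure d) =
      ∫ z, (((Real.pi ^ d)⁻¹ * Real.exp (-‖z‖ ^ 2) : ℝ) : ℂ) * g z := by
  have hm : Measurable fun z : CSpace d =>
      ((Real.pi ^ d)⁻¹ * Real.exp (-‖z‖ ^ 2)).toNNReal := by fun_prop
  have h : gaussMeasure d = volume.withDensity
      (fun z : CSpace d => (((Real.pi ^ d)⁻¹ * Real.exp (-‖z‖ ^ 2)).toNNReal : ENNReal)) := rfl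
  rw [h, integral_withDensity_eq_integral_smul hm]
  refine integral_congr_ae (Filter.Eventually.of_forall fun z => ?_)
  have : 0 ≤ (Real.pi ^ d)⁻¹ * Real.exp (-‖z‖ ^ 2) := by positivity
  simp only [NNReal.smul_def, Real.coe_toNNReal _ this, Complex.real_smul]

open MeasureTheory in
theorem integrable_gaussMeasure_iff {d : ℕ} (g : CSpace d → ℂ) :
    Integrable g (gaussMeasure d) ↔
      Integrable (fun z => (((Real.pi ^ d)⁻¹ * Real.exp (-‖z‖ ^ 2) : ℝ) : ℂ) * g z) := by
  have hm : Measurable fun z : CSpace d =>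
      ((Real.pi ^ d)⁻¹ * Real.exp (-‖z‖ ^ 2)).toNNReal := by fun_prop
  have h : gaussMeasure d = volume.withDensity
      (fun z : CSpace d => (((Real.pi ^ d)⁻¹ * Real.exp (-‖z‖ ^ 2)).toNNReal : ENNReal)) := rfl
  rw [h, integrable_withDensity_iff_integrable_smul hm]
  refine integrable_congr (Filter.Eventually.of_forall fun z => ?_)
  have : 0 ≤ (Real.pi ^ d)⁻¹ * Real.exp (-‖z‖ ^ 2) := by positivity
  simp only [NNReal.smul_def, Real.coe_toNNReal _ this, Complex.real_smul]

/-- The Gaussian measure is invariant under linear isometries. -/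
theorem measurePreserving_gaussMeasure {d : ℕ} (e : CSpace d ≃ₗᵢ[ℝ] CSpace d) :
    MeasureTheory.MeasurePreserving e (gaussMeasure d) (gaussMeasure d) := by
  refine ⟨e.continuous.measurable, ?_⟩
  ext s hs
  rw [MeasureTheory.Measure.map_apply e.continuous.measurable hs, gaussMeasure,
    MeasureTheory.withDensity_apply _ hs,
    MeasureTheory.withDensity_apply _ (e.continuous.measurable hs),
    ← e.measurePreserving.setLIntegral_comp_preimage hs (by fun_prop)]
  simp

/-- Multiplication by a number of the unit circle. -/
def circleRotation {d : ℕ} (θ : ℝ) : CSpace d ≃ₗᵢ[ℝ] CSpace d :=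
  LinearIsometryEquiv.mk ((LinearEquiv.smulOfNeZero ℂ (CSpace d) (circleMap 0 1 θ)
    (circleMap_ne_center one_ne_zero)).restrictScalars ℝ) (fun w => by simp [norm_smul])

open MeasureTheory in
/-- The mean value property of entire functions for the Gaussian measure. -/
theorem integral_gaussMeasure_eq_apply_zero {d : ℕ} {h : CSpace d → ℂ} (hh : Differentiable ℂ h)
    (hi : Integrable h (gaussMeasure d)) : ∫ z, h z ∂(gaussMeasure d) = h 0 := by
  have hc := hh.continuous
  have rot : ∀ θ : ℝ, ∫ w, h (circleMap 0 1 θ • w) ∂(gaussMeasure d) =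
      ∫ w, h w ∂(gaussMeasure d) := fun θ =>
    (measurePreserving_gaussMeasure (circleRotation θ)).integral_comp
      (circleRotation θ).toHomeomorph.measurableEmbedding h
  have rotn : ∀ θ : ℝ, ∫ w, ‖h (circleMap 0 1 θ • w)‖ ∂(gaussMeasure d) =
      ∫ w, ‖h w‖ ∂(gaussMeasure d) := fun θ =>
    (measurePreserving_gaussMeasure (circleRotation θ)).integral_comp
      (circleRotation θ).toHomeomorph.measurableEmbedding (fun w => ‖h w‖)
  have avg : ∀ w : CSpace d,
      ∫ θ in (0 : ℝ)..2 * Real.pi, h (circleMap 0 1 θ • w) = (2 * Real.pi : ℝ) • h 0 := by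
    intro w
    have hd : Differentiable ℂ (fun t : ℂ => h (t • w)) := by fun_prop
    have := (hd.diffContOnCl (s := Metric.ball 0 |1|)).circleAverage
    rw [Real.circleAverage_def, inv_smul_eq_iff₀ (by positivity)] at this
    simpa using this
  -- Fubini: rotation invariance evaluates one order of integration, the mean value property on each
  -- complex line through `0` the other.
  have swap := intervalIntegral_integral_swap (a := 0) (b := 2 * Real.pi)
    (μ := gaussMeasure d) (f := fun (θ : ℝ) (w : CSpace d) => h (circleMap 0 1 θ • w)) (by
      have hcont : Continuous (fun p : ℝ × CSpace d => h (circleMap 0 1 p.1 • p.2)) := by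
        fun_prop
      refine (integrable_prod_iff hcont.aestronglyMeasurable).2 ⟨?_, ?_⟩
      · refine Filter.Eventually.of_forall fun θ => ?_
        exact ((measurePreserving_gaussMeasure (circleRotation θ)).integrable_comp_emb
          (circleRotation θ).toHomeomorph.measurableEmbedding).2 hi
      · have : IsFiniteMeasure (volume.restrict (Set.uIoc 0 (2 * Real.pi))) :=
          isFiniteMeasure_restrict.2 (by simp [Set.uIoc])
        simp only [rotn]
        exact integrable_const _)
  simp only [rot, avg] at swap
  rw [intervalIntegral.integral_const, integral_const] at swap
  have hpi : (Real.pi : ℂ) ≠ 0 := by exact_mod_cast Real.pi_ne_zero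
  simp only [Complex.real_smul] at swap
  push_cast at swap
  simp at swap
  tauto

/-! ## Reproducing kernels -/

/-- Translating the Gaussian weight. -/
theorem gaussWeight_translate {d : ℕ} (w z : CSpace d) :
    ((Real.exp (-‖z + w‖ ^ 2) : ℝ) : ℂ) * (starRingEnd ℂ) (Complex.exp (inner ℂ w (z + w))) =
      ((Real.exp (-‖z‖ ^ 2) : ℝ) : ℂ) * Complex.exp (-inner ℂ w z) := by
  rw [Complex.ofReal_exp, Complex.ofReal_exp, ← Complex.exp_conj, ← Complex.exp_add,
    ← Complex.exp_add, inner_conj_symm]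
  congr 1
  push_cast
  have h1 := inner_self_eq_norm_sq_to_K (𝕜 := ℂ) (z + w)
  have h2 := inner_self_eq_norm_sq_to_K (𝕜 := ℂ) z
  simp only [Complex.coe_algebraMap] at h1 h2
  rw [← h1, ← h2, inner_add_left, inner_add_left, inner_add_right, inner_add_right]
  ring

theorem differentiable_exp_inner {d : ℕ} (w : CSpace d) :
    Differentiable ℂ fun z : CSpace d => Complex.exp (inner ℂ w z) :=
  (innerSL ℂ w).differentiable.cexp

-- Completing the square turns the weighted square modulus into `e^{|w|²}` times a translated
-- Gaussian.
open MeasureTheory in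
theorem memLp_exp_inner {d : ℕ} (w : CSpace d) :
    MemLp (fun z : CSpace d => Complex.exp (inner ℂ w z)) 2 (gaussMeasure d) := by
  have hc := (differentiable_exp_inner w).continuous
  refine (memLp_two_iff_integrable_sq_norm hc.aestronglyMeasurable).2 ?_
  have key : ∀ z : CSpace d, Real.exp (-‖z‖ ^ 2) * ‖Complex.exp (inner ℂ w z)‖ ^ 2 =
      Real.exp (‖w‖ ^ 2) * Real.exp (-‖z - w‖ ^ 2) := by
    intro z
    rw [Complex.norm_exp, ← Real.exp_nat_mul, ← Real.exp_add, ← Real.exp_add, @norm_sub_sq ℂ,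
      ← inner_conj_symm]
    simp only [Nat.cast_ofNat, Complex.conj_re, RCLike.re_to_complex]
    congr 1
    ring
  have h0 : Integrable (fun z : CSpace d => ((‖Complex.exp (inner ℂ w z)‖ ^ 2 : ℝ) : ℂ))
      (gaussMeasure d) := by
    rw [integrable_gaussMeasure_iff]
    have h1 : Integrable (fun z : CSpace d => Real.exp (-‖z‖ ^ 2)) := by
      have := (integrable_gaussMeasure_iff (d := d) (fun _ => (1 : ℂ))).1 (integrable_const _)
      simp only [mul_one] at this
      have := this.re.const_mul (Real.pi ^ d)
      refine this.congr (Filter.Eventually.of_forall fun z => ?_)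
      have hp : Real.pi ^ d ≠ 0 := by positivity
      simp only [RCLike.re_to_complex, Complex.ofReal_re]
      field_simp
    have h2 := ((h1.comp_sub_right w).const_mul ((Real.pi ^ d)⁻¹ * Real.exp (‖w‖ ^ 2))).ofReal
      (𝕜 := ℂ)
    refine h2.congr (Filter.Eventually.of_forall fun z => ?_)
    simp only [Complex.coe_algebraMap]
    rw [← Complex.ofReal_mul, mul_assoc, mul_assoc, key z]
  exact h0.re

/-- The reproducing kernel `z ↦ e^{⟨z, w⟩}` of the Fock space. -/
def fockKernel {d : ℕ} (w : CSpace d) : FockSpace d :=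
  ⟨fun z => Complex.exp (inner ℂ w z), differentiable_exp_inner w, memLp_exp_inner w⟩

theorem fockKernel_apply {d : ℕ} (w z : CSpace d) :
    fockKernel w z = Complex.exp (inner ℂ w z) := rfl

-- Translating by `w` turns the weighted integrand into the Gaussian times the entire function `f (z
-- + w) e^{-⟨z, w⟩}`, whose mean is its value at `0`.
open MeasureTheory in
theorem inner_fockKernel {d : ℕ} (w : CSpace d) (f : FockSpace d) :
    inner ℂ (fockKernel w) f = f w := by
  have hi := FockSpace.integrable_mul_conj (fockKernel w) f
  have e : ∀ z : CSpace d, (((Real.pi ^ d)⁻¹ * Real.exp (-‖z + w‖ ^ 2) : ℝ) : ℂ) *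
      (f (z + w) * (starRingEnd ℂ) (fockKernel w (z + w))) =
      (((Real.pi ^ d)⁻¹ * Real.exp (-‖z‖ ^ 2) : ℝ) : ℂ) *
        (f (z + w) * Complex.exp (-inner ℂ w z)) := fun z => by
    have := gaussWeight_translate w z
    rw [fockKernel_apply, Complex.ofReal_mul, Complex.ofReal_mul]
    linear_combination ((Real.pi ^ d)⁻¹ : ℝ) * f (z + w) * this
  have hd : Differentiable ℂ fun z => f (z + w) * Complex.exp (-inner ℂ w z) := by
    have h1 : Differentiable ℂ fun z => f (z + w) :=
      f.differentiable.comp (differentiable_id.add_const w)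
    exact h1.mul (innerSL ℂ w).differentiable.neg.cexp
  rw [FockSpace.inner_eq, integral_gaussMeasure, ← integral_add_right_eq_self _ w]
  simp only [e]
  rw [← integral_gaussMeasure, integral_gaussMeasure_eq_apply_zero hd]
  · simp
  · rw [integrable_gaussMeasure_iff]
    have := ((integrable_gaussMeasure_iff _).1 hi).comp_add_right w
    simpa only [e] using this

theorem norm_fockKernel_sq {d : ℕ} (w : CSpace d) :
    ‖fockKernel w‖ ^ 2 = Real.exp (‖w‖ ^ 2) := by
  have h := inner_self_eq_norm_sq_to_K (𝕜 := ℂ) (fockKernel w)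
  rw [inner_fockKernel, fockKernel_apply, inner_self_eq_norm_sq_to_K] at h
  simp only [Complex.coe_algebraMap] at h
  exact_mod_cast h.symm

/-- If nonzero multiples of two kernels agree, then so do the factors and the points. -/
theorem eq_of_smul_exp_inner {d : ℕ} {a b : CSpace d} {s t : ℂ} (hs : s ≠ 0)
    (h : ∀ z, s * Complex.exp (inner ℂ a z) = t * Complex.exp (inner ℂ b z)) :
    s = t ∧ a = b := by
  have hst : s = t := by simpa using h 0
  refine ⟨hst, ?_⟩
  subst hst
  have h1 : ∀ z, Complex.exp (inner ℂ (a - b) z) = 1 := fun z => by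
    rw [inner_sub_left, Complex.exp_sub, mul_left_cancel₀ hs (h z), div_self (Complex.exp_ne_zero _)]
  -- At `z = a - b` the exponent is `‖a - b‖²`, so it must vanish.
  have h2 := h1 (a - b)
  have h3 := congrArg norm h2
  rw [Complex.norm_exp, norm_one, Real.exp_eq_one_iff] at h3
  have h4 : RCLike.re (inner ℂ (a - b) (a - b)) = 0 := h3
  rw [inner_self_eq_norm_sq (𝕜 := ℂ)] at h4
  exact sub_eq_zero.1 (norm_eq_zero.1 (pow_eq_zero_iff two_ne_zero |>.1 h4))

/-! ## Entire maps of at most linear growth in the mean -/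

/-- Applied with `x = ‖p n‖²` and `R = r²` to discard the Taylor coefficients of order at least two.
-/
theorem eq_zero_of_mul_pow_le {x C a : ℝ} (hx : 0 ≤ x) {n : ℕ} (hn : 2 ≤ n)
    (h : ∀ R : ℝ, 1 ≤ R → x * R ^ n ≤ C + a * R) : x = 0 := by
  by_contra h0
  have hx' : 0 < x := lt_of_le_of_ne hx (Ne.symm h0)
  have hK : 0 ≤ (|C| + |a|) / x := by positivity
  -- Chosen so that `x R = |C| + |a| + x`; then `x R²` exceeds `C + a R`.
  set R := (|C| + |a|) / x + 1 with hR
  have hR1 : 1 ≤ R := by linarith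
  have h1 := h R hR1
  have h2 : R ^ 2 ≤ R ^ n := pow_le_pow_right₀ hR1 hn
  have h3 : x * R = |C| + |a| + x := by rw [hR]; field_simp
  nlinarith [le_abs_self C, le_abs_self a, abs_nonneg C, mul_le_mul_of_nonneg_left h2 hx]

theorem le_of_mul_le_add {x C a : ℝ} (h : ∀ R : ℝ, 1 ≤ R → x * R ≤ C + a * R) : x ≤ a := by
  by_contra! h0
  have hK : 0 ≤ |C| / (x - a) := div_nonneg (abs_nonneg _) (by linarith)
  have h1 := h (|C| / (x - a) + 1) (by linarith)
  have h3 : (x - a) * (|C| / (x - a) + 1) = |C| + (x - a) := by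
    have : x - a ≠ 0 := by linarith
    field_simp
  nlinarith [le_abs_self C]

-- Average `2 m u ≤ m² + u²`, where `m` is the mean of `u`.
open Real in
theorem circleAverage_sq_le {u : ℂ → ℝ} (hu : Continuous u) (r : ℝ) :
    circleAverage u 0 r ^ 2 ≤ circleAverage (fun t => u t ^ 2) 0 r := by
  set m := circleAverage u 0 r with hm
  have i1 : CircleIntegrable (fun t => u t ^ 2) 0 r :=
    (hu.pow 2).continuousOn.circleIntegrable'
  have i2 : CircleIntegrable (fun t => (2 * m) • u t) 0 r := by
    have : Continuous fun t => (2 * m) • u t := by fun_prop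
    exact this.continuousOn.circleIntegrable'
  have i3 : CircleIntegrable (fun t => m ^ 2 + u t ^ 2) 0 r := by
    have : Continuous fun t => m ^ 2 + u t ^ 2 := by fun_prop
    exact this.continuousOn.circleIntegrable'
  have h := circleAverage_mono i2 i3
    (fun t _ => by simp only [smul_eq_mul]; nlinarith [sq_nonneg (u t - m)])
  rw [circleAverage_fun_smul, circleAverage_fun_add
    (continuous_const.continuousOn.circleIntegrable') i1, circleAverage_const, ← hm] at h
  simp only [smul_eq_mul] at h
  nlinarith

open Real in
/-- An entire map whose square norm grows at most quadratically in the mean is affine. -/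
theorem affine_of_circleAverage_le {E : Type*} [NormedAddCommGroup E] [NormedSpace ℂ E]
    [CompleteSpace E] {g : ℂ → E} (hg : Differentiable ℂ g) {C a : ℝ} (ha : 0 ≤ a)
    (h : ∀ r : ℝ, 0 < r → circleAverage (fun t => ‖g t‖ ^ 2) 0 r ≤ C + a ^ 2 * r ^ 2) :
    (∀ t, g t = g 0 + t • deriv g 0) ∧ ‖deriv g 0‖ ≤ a := by
  have hp := hg.hasFPowerSeriesOnBall 0 (R := 1) one_pos
  set p := cauchyPowerSeries g 0 ((1 : NNReal) : ℝ) with hpdef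
  -- The Cauchy estimate on the circle of radius `r = √R`, squared. The coefficients do not depend
  -- on the radius, so `p` serves for every `r`.
  have bound : ∀ n, ∀ R : ℝ, 1 ≤ R → ‖p n‖ ^ 2 * R ^ n ≤ C + a ^ 2 * R := by
    intro n R hR
    have hR0 : 0 < R := by linarith
    set r : NNReal := ⟨√R, Real.sqrt_nonneg R⟩ with hr
    have hr0 : 0 < r := Real.sqrt_pos.2 hR0
    have hrr : (r : ℝ) ^ 2 = R := Real.sq_sqrt hR0.le
    have hr0' : (0 : ℝ) < r := hr0
    have heq : p = cauchyPowerSeries g 0 r :=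
      hp.hasFPowerSeriesAt.eq_formalMultilinearSeries
        (hg.hasFPowerSeriesOnBall 0 hr0).hasFPowerSeriesAt
    have h1 := norm_cauchyPowerSeries_le g 0 r n
    rw [← heq] at h1
    have h2 : (2 * π)⁻¹ * ∫ θ in (0 : ℝ)..2 * π, ‖g (circleMap 0 r θ)‖ =
      circleAverage (fun t => ‖g t‖) 0 r := rfl
    rw [h2, abs_of_pos hr0', inv_pow, ← div_eq_mul_inv, le_div_iff₀ (by positivity)] at h1
    have h3 := circleAverage_sq_le hg.continuous.norm (r : ℝ)
    have h4 := pow_le_pow_left₀ (by positivity) h1 2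
    have h5 := h r hr0'
    rw [hrr] at h5
    calc ‖p n‖ ^ 2 * R ^ n = (‖p n‖ * (r : ℝ) ^ n) ^ 2 := by
          rw [← hrr]; ring
      _ ≤ _ := h4.trans (h3.trans h5)
  have hd : deriv g 0 = p 1 fun _ => 1 := hp.hasFPowerSeriesAt.deriv
  refine ⟨fun t => ?_, ?_⟩
  · have hs := hp.hasSum (y := t) (by simp)
    have hz : ∀ n ∉ Finset.range 2, (p n fun _ => t) = 0 := fun n hn => by
      have h0 : ‖p n‖ ^ 2 = 0 :=
        eq_zero_of_mul_pow_le (by positivity) (not_lt.1 fun h => hn (Finset.mem_range.2 h)) (bound n)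
      have : p n = 0 := norm_eq_zero.1 (pow_eq_zero_iff two_ne_zero |>.1 h0)
      simp [this]
    have hu := hs.unique (hasSum_sum_of_ne_finset_zero hz)
    rw [zero_add, Finset.sum_range_succ, Finset.sum_range_one, hp.coeff_zero] at hu
    rw [hu, hd]
    congr 1
    simp
  · have h1 : ‖p 1‖ ^ 2 ≤ a ^ 2 := le_of_mul_le_add (C := C) (by simpa using bound 1)
    have h2 : ‖p 1‖ ≤ a := (pow_le_pow_iff_left₀ (norm_nonneg _) ha two_ne_zero).1 h1
    rw [hd]
    exact ((p 1).le_opNorm _).trans (by simpa using h2)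

open Real in
/-- The symbol of a bounded weighted composition operator whose weight has no zeros is affine, and
its linear part is a contraction. -/
theorem affine_of_weight_bound {E F : Type*} [NormedAddCommGroup E] [NormedSpace ℂ E]
    [NormedAddCommGroup F] [NormedSpace ℂ F] [CompleteSpace F]
    {ψ : E → ℂ} {φ : E → F} (hψ : Differentiable ℂ ψ) (hφ : Differentiable ℂ φ)
    (h0 : ∀ z, ψ z ≠ 0) {M : ℝ}
    (h : ∀ z, ‖ψ z‖ ^ 2 * Real.exp (‖φ z‖ ^ 2) ≤ M * Real.exp (‖z‖ ^ 2)) (z : E) :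
    φ z = φ 0 + fderiv ℂ φ 0 z ∧ ‖fderiv ℂ φ 0 z‖ ≤ ‖z‖ := by
  have hM : 0 < M := by
    have h1 := h 0
    have h2 : 0 < ‖ψ 0‖ ^ 2 * Real.exp (‖φ 0‖ ^ 2) := by
      have := norm_pos_iff.2 (h0 0)
      positivity
    exact pos_of_mul_pos_left (h2.trans_le h1) (Real.exp_pos _).le
  have hlog : ∀ w, 2 * log ‖ψ w‖ + ‖φ w‖ ^ 2 ≤ log M + ‖w‖ ^ 2 := fun w => by
    have hw := norm_pos_iff.2 (h0 w)
    have := Real.log_le_log (by positivity) (h w)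
    rw [Real.log_mul (by positivity) (by positivity), Real.log_mul (by positivity) (by positivity),
      Real.log_exp, Real.log_exp, Real.log_pow] at this
    exact_mod_cast this
  have hg : Differentiable ℂ fun t : ℂ => φ (t • z) := by fun_prop
  have hs : Differentiable ℂ fun t : ℂ => ψ (t • z) := by fun_prop
  have hder : deriv (fun t : ℂ => φ (t • z)) 0 = fderiv ℂ φ 0 z := by
    have h1 : HasFDerivAt φ (fderiv ℂ φ 0) ((0 : ℂ) • z) := by
      rw [zero_smul]
      exact (hφ 0).hasFDerivAt
    have h2 : HasDerivAt (fun t : ℂ => t • z) z 0 := by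
      simpa using (hasDerivAt_id (0 : ℂ)).smul_const z
    exact (h1.comp_hasDerivAt 0 h2).deriv
  -- As `ψ` has no zeros, `log ‖ψ (t • z)‖` has circle average `log ‖ψ 0‖`, which moves into the
  -- constant.
  have key := affine_of_circleAverage_le hg (C := log M - 2 * log ‖ψ 0‖) (norm_nonneg z)
    (fun r hr => by
      have c1 : Continuous fun t : ℂ => log ‖ψ (t • z)‖ :=
        hs.continuous.norm.log fun t => (norm_pos_iff.2 (h0 _)).ne'
      have i1 : CircleIntegrable (fun t : ℂ => (2 : ℝ) • log ‖ψ (t • z)‖) 0 r :=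
        (c1.const_smul (2 : ℝ)).continuousOn.circleIntegrable'
      have i2 : CircleIntegrable (fun t : ℂ => ‖φ (t • z)‖ ^ 2) 0 r :=
        (hg.continuous.norm.pow 2).continuousOn.circleIntegrable'
      have hle := circleAverage_mono_on_of_le_circle (a := log M + ‖z‖ ^ 2 * r ^ 2) (i1.add i2)
        (fun t ht => by
          have ht' : ‖t‖ = r := by simpa [abs_of_pos hr] using ht
          have := hlog (t • z)
          rw [norm_smul, ht'] at this
          simp only [Pi.add_apply, smul_eq_mul]
          linarith [mul_pow r ‖z‖ 2])
      rw [circleAverage_add i1 i2, circleAverage_fun_smul,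
        AnalyticOnNhd.circleAverage_log_norm_of_ne_zero
          (fun t _ => hs.analyticAt t) (fun t _ => h0 _)] at hle
      simp only [zero_smul, smul_eq_mul] at hle
      linarith)
  rw [hder] at key
  refine ⟨?_, key.2⟩
  simpa using key.1 1

/-! ## Normal operators -/

section Normal

variable {H : Type*} [NormedAddCommGroup H] [InnerProductSpace ℂ H] [CompleteSpace H]

open ContinuousLinearMap in
theorem adjoint_apply_apply_comm {N : H →L[ℂ] H} (hN : IsStarNormal N) (x : H) :
    adjoint N (N x) = N (adjoint N x) :=
  DFunLike.congr_fun (hN.star_comm_self.eq : star N * N = N * star N) x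

open ContinuousLinearMap in
/-- If the norms of `g`, `N g`, `N² g` are in geometric progression and `N` is normal, then
`N* N g` is a multiple of `g`. -/
theorem adjoint_apply_apply_eq_smul {N : H →L[ℂ] H} (hN : IsStarNormal N) {g : H}
    (h : ‖N (N g)‖ * ‖g‖ = ‖N g‖ ^ 2) : ∃ c : ℂ, adjoint N (N g) = c • g := by
  rcases eq_or_ne g 0 with rfl | hg
  · exact ⟨0, by simp⟩
  have hg' : ‖g‖ ≠ 0 := norm_ne_zero_iff.2 hg
  refine ⟨((‖N g‖ ^ 2 / ‖g‖ ^ 2 : ℝ) : ℂ), ?_⟩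
  -- The only possible factor, since `⟨N* N g, g⟩ = ‖N g‖²`. Expand `‖N* N g - c g‖²`; normality
  -- replaces `‖N* N g‖` by `‖N² g‖`, and the terms cancel.
  set c : ℝ := ‖N g‖ ^ 2 / ‖g‖ ^ 2 with hc
  rw [← sub_eq_zero, ← norm_eq_zero, ← pow_eq_zero_iff two_ne_zero, @norm_sub_sq ℂ,
    ← ContinuousLinearMap.isStarNormal_iff_norm_eq_adjoint.1 hN, adjoint_inner_left, map_smul, inner_smul_right, inner_self_eq_norm_sq_to_K, norm_smul]
  have h1 : RCLike.re ((c : ℂ) * ((‖N g‖ : ℝ) : ℂ) ^ 2) = c * ‖N g‖ ^ 2 := by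
    rw [← Complex.ofReal_pow, ← Complex.ofReal_mul]; rfl
  have h2 : ‖(c : ℂ)‖ = c := by
    rw [Complex.norm_real, Real.norm_of_nonneg (by positivity)]
  have h3 : ‖N (N g)‖ = ‖N g‖ ^ 2 / ‖g‖ := by
    rw [eq_div_iff hg', h]
  simp only [Complex.coe_algebraMap]
  rw [h1, h2, h3, hc]
  field_simp
  ring

end Normal

/-! ## Linear contractions of a finite dimensional space -/

section Contraction

variable {E : Type*} [NormedAddCommGroup E] [InnerProductSpace ℂ E] [CompleteSpace E]

-- Here `⟨L v, v⟩ = ⟨v, L* v⟩ = ‖v‖²`, so `‖L v - v‖² = ‖L v‖² - ‖v‖² ≤ 0`.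
open ContinuousLinearMap in
theorem apply_eq_self_of_adjoint_apply_eq_self {L : E →L[ℂ] E} (hL : ∀ z, ‖L z‖ ≤ ‖z‖) {v : E}
    (hv : adjoint L v = v) : L v = v := by
  rw [← sub_eq_zero, ← norm_eq_zero, ← pow_eq_zero_iff two_ne_zero]
  refine le_antisymm ?_ (by positivity)
  rw [@norm_sub_sq ℂ, ← adjoint_inner_right, hv, inner_self_eq_norm_sq]
  nlinarith [hL v, norm_nonneg (L v), norm_nonneg v]

open ContinuousLinearMap in
/-- Every vector is the sum of a vector fixed by a contraction and its adjoint, and of a vector in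
the range of `1 - L`. -/
theorem exists_fixed_add_range [FiniteDimensional ℂ E] {L : E →L[ℂ] E}
    (hL : ∀ z, ‖L z‖ ≤ ‖z‖) (q : E) :
    ∃ p q₀ : E, q = q₀ + (p - L p) ∧ L q₀ = q₀ ∧ adjoint L q₀ = q₀ := by
  -- The orthogonal complement of the range of `1 - L` is the kernel of `1 - L*`.
  obtain ⟨y, hy, q₀, hq₀, hsum⟩ :=
    (LinearMap.range ((1 - L : E →L[ℂ] E) : E →ₗ[ℂ] E)).exists_add_mem_mem_orthogonal q
  obtain ⟨p, rfl⟩ := hy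
  have hfix : adjoint L q₀ = q₀ := by
    refine ext_inner_left ℂ fun v => ?_
    have := (Submodule.mem_orthogonal _ _).1 hq₀ _ (LinearMap.mem_range_self _ v)
    simp only [ContinuousLinearMap.coe_coe, sub_apply,
      one_apply_eq_self, inner_sub_left] at this
    rw [adjoint_inner_right]
    exact (sub_eq_zero.1 this).symm
  refine ⟨p, q₀, ?_, apply_eq_self_of_adjoint_apply_eq_self hL hfix, hfix⟩
  rw [hsum, add_comm]
  rfl

end Contraction

/-! ## The symbols of a normal weighted composition operator -/

section Symbols

variable {d : ℕ} {ψ : CSpace d → ℂ} {φ : CSpace d → CSpace d} {B : FockSpace d →L[ℂ] FockSpace d}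

open ContinuousLinearMap in
theorem adjoint_fockKernel (hB : ∀ f z, B f z = ψ z * f (φ z)) (w : CSpace d) :
    adjoint B (fockKernel w) = (starRingEnd ℂ) (ψ w) • fockKernel (φ w) := by
  ext z
  rw [← inner_fockKernel, adjoint_inner_right, ← inner_conj_symm, inner_fockKernel, hB,
    FockSpace.smul_apply, fockKernel_apply, fockKernel_apply, map_mul, ← Complex.exp_conj,
    inner_conj_symm]

/-- At a zero `w` of `ψ`, `B* K_w = 0`, hence `B K_w = 0` by normality; as `K_w` vanishes nowhere,
`ψ` would be zero. -/
theorem weight_ne_zero (hB : ∀ f z, B f z = ψ z * f (φ z)) (hN : IsStarNormal B) (hψ0 : ψ ≠ 0)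
    (w : CSpace d) : ψ w ≠ 0 := by
  intro h0
  have h1 := ContinuousLinearMap.isStarNormal_iff_norm_eq_adjoint.1 hN (fockKernel w)
  rw [adjoint_fockKernel hB, h0, map_zero, zero_smul, norm_zero, norm_eq_zero] at h1
  refine hψ0 (funext fun z => ?_)
  have h2 := hB (fockKernel w) z
  rw [h1, FockSpace.zero_apply, fockKernel_apply, eq_comm, mul_eq_zero] at h2
  exact h2.resolve_right (Complex.exp_ne_zero _)

open ContinuousLinearMap in
theorem weight_bound (hB : ∀ f z, B f z = ψ z * f (φ z)) (z : CSpace d) :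
    ‖ψ z‖ ^ 2 * Real.exp (‖φ z‖ ^ 2) ≤ ‖adjoint B‖ ^ 2 * Real.exp (‖z‖ ^ 2) := by
  have h := pow_le_pow_left₀ (norm_nonneg _) ((adjoint B).le_opNorm (fockKernel z)) 2
  rwa [adjoint_fockKernel hB, norm_smul, RCLike.norm_conj, mul_pow, mul_pow, norm_fockKernel_sq,
    norm_fockKernel_sq] at h

/-- Along a direction `q₀` which is only translated, the weight is an exponential. -/
theorem weight_translate (hψ : Differentiable ℂ ψ) {M : ℝ}
    (h : ∀ z, ‖ψ z‖ ^ 2 * Real.exp (‖φ z‖ ^ 2) ≤ M * Real.exp (‖z‖ ^ 2)) {p q₀ : CSpace d}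
    (hp : ∀ t : ℂ, φ (p + t • q₀) = p + t • q₀ + q₀) :
    ψ (p + q₀) * Complex.exp ((‖q₀‖ ^ 2 : ℝ) : ℂ) = ψ p := by
  -- The exponential factor compensates the growth `2 Re t ‖q₀‖²` of `‖φ‖² - ‖z‖²` along the line,
  -- so `g` is bounded and Liouville's theorem applies.
  set g : ℂ → ℂ := fun t => ψ (p + t • q₀) * Complex.exp (t * ((‖q₀‖ ^ 2 : ℝ) : ℂ)) with hg
  have hd : Differentiable ℂ g := by fun_prop
  have hb : ∀ t, ‖g t‖ ^ 2 ≤ M * Real.exp (-(2 * (inner ℂ p q₀ : ℂ).re + ‖q₀‖ ^ 2)) := by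
    intro t
    have h1 := h (p + t • q₀)
    have h2 : ‖φ (p + t • q₀)‖ ^ 2 =
        ‖p + t • q₀‖ ^ 2 + 2 * (inner ℂ p q₀ : ℂ).re + 2 * t.re * ‖q₀‖ ^ 2 + ‖q₀‖ ^ 2 := by
      rw [hp, @norm_add_sq ℂ _ _ _ _ (p + t • q₀), inner_add_left, inner_smul_left,
        inner_self_eq_norm_sq_to_K]
      simp only [Complex.coe_algebraMap, RCLike.re_to_complex, ← Complex.ofReal_pow,
        Complex.add_re, Complex.re_mul_ofReal, Complex.conj_re]
      ring
    have h3 : ‖g t‖ ^ 2 = ‖ψ (p + t • q₀)‖ ^ 2 * Real.exp (2 * t.re * ‖q₀‖ ^ 2) := by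
      rw [hg, norm_mul, mul_pow, Complex.norm_exp, Complex.re_mul_ofReal, ← Real.exp_nat_mul]
      congr 2
      push_cast
      ring
    have h4 : Real.exp (‖φ (p + t • q₀)‖ ^ 2) = Real.exp (‖p + t • q₀‖ ^ 2) *
        Real.exp (2 * (inner ℂ p q₀ : ℂ).re + ‖q₀‖ ^ 2) * Real.exp (2 * t.re * ‖q₀‖ ^ 2) := by
      rw [h2, ← Real.exp_add, ← Real.exp_add]
      congr 1
      ring
    rw [h3, Real.exp_neg, ← div_eq_mul_inv, le_div_iff₀ (Real.exp_pos _)]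
    rw [h4] at h1
    refine le_of_mul_le_mul_right ?_ (Real.exp_pos (‖p + t • q₀‖ ^ 2))
    linarith
  have hbdd : Bornology.IsBounded (Set.range g) := by
    refine isBounded_iff_forall_norm_le.2
      ⟨√(M * Real.exp (-(2 * (inner ℂ p q₀ : ℂ).re + ‖q₀‖ ^ 2))), ?_⟩
    rintro _ ⟨t, rfl⟩
    exact Real.le_sqrt_of_sq_le (hb t)
  have := hd.apply_eq_apply_of_bounded hbdd 1 0
  simpa [hg] using this

open ContinuousLinearMap in
theorem apply_fockKernel (hB : ∀ f z, B f z = ψ z * f (φ z)) {L : CSpace d →L[ℂ] CSpace d}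
    {q s : CSpace d} (hφ : ∀ z, φ z = L z + q) (hψ : ∀ z, ψ z = ψ 0 * Complex.exp (inner ℂ s z))
    (w : CSpace d) : B (fockKernel w) =
      (ψ 0 * Complex.exp (inner ℂ w q)) • fockKernel (adjoint L w + s) := by
  ext z
  rw [hB, hψ z, hφ, FockSpace.smul_apply, fockKernel_apply, fockKernel_apply, inner_add_left,
    inner_add_right, adjoint_inner_left, Complex.exp_add, Complex.exp_add]
  ring

open ContinuousLinearMap in
/-- The symbols of a bounded normal weighted composition operator. -/
theorem exists_symbols (hψ : Differentiable ℂ ψ) (hψ0 : ψ ≠ 0) (hφ : Differentiable ℂ φ)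
    (hB : ∀ f z, B f z = ψ z * f (φ z)) (hN : IsStarNormal B) :
    ∃ (L : CSpace d →L[ℂ] CSpace d) (q s p q₀ : CSpace d),
      (∀ z, φ z = L z + q) ∧ (∀ z, ψ z = ψ 0 * Complex.exp (inner ℂ s z)) ∧
      q = q₀ + (p - L p) ∧ s = p - adjoint L p - q₀ ∧ L q₀ = q₀ ∧ adjoint L q₀ = q₀ ∧
      (∀ w, adjoint L (L w + q) + s = L (adjoint L w + s) + q) := by
  have hne := weight_ne_zero hB hN hψ0
  have hbd := weight_bound hB
  have haff := affine_of_weight_bound hψ hφ hne hbd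
  set L := fderiv ℂ φ 0 with hL
  set q := φ 0 with hq
  have hφL : ∀ z, φ z = L z + q := fun z => by rw [add_comm]; exact (haff z).1
  obtain ⟨p, q₀, hqp, hLq, hLq'⟩ := exists_fixed_add_range (fun z => (haff z).2) q
  have htr : ∀ t : ℂ, φ (p + t • q₀) = p + t • q₀ + q₀ := fun t => by
    rw [hφL, hqp, map_add, map_smul, hLq]
    abel
  have htr0 : φ p = p + q₀ := by simpa using htr 0
  have htr1 : φ (p + q₀) = p + q₀ + q₀ := by simpa using htr 1
  have hprog := weight_translate hψ hbd htr
  have hnorm : ‖adjoint B (adjoint B (fockKernel p))‖ * ‖fockKernel p‖ =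
      ‖adjoint B (fockKernel p)‖ ^ 2 := by
    rw [adjoint_fockKernel hB, map_smul, adjoint_fockKernel hB, htr0, htr1, norm_smul, norm_smul,
      norm_smul, RCLike.norm_conj, RCLike.norm_conj]
    -- The parallelogram law for `p + q₀` and `q₀`; the surplus `e^{‖q₀‖²}` is what the weight loses
    -- from `p` to `p + q₀`.
    have h1 : ‖fockKernel (p + q₀ + q₀)‖ * ‖fockKernel p‖ =
        Real.exp (‖q₀‖ ^ 2) * ‖fockKernel (p + q₀)‖ ^ 2 := by
      refine (pow_left_inj₀ (by positivity) (by positivity) two_ne_zero).1 ?_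
      rw [mul_pow, mul_pow, norm_fockKernel_sq, norm_fockKernel_sq, norm_fockKernel_sq,
        ← Real.exp_add, ← Real.exp_nat_mul, ← Real.exp_nat_mul, ← Real.exp_add]
      congr 1
      have := parallelogram_law_with_norm ℂ (p + q₀) q₀
      rw [add_sub_cancel_right] at this
      push_cast
      linarith
    have h2 : ‖ψ (p + q₀)‖ * Real.exp (‖q₀‖ ^ 2) = ‖ψ p‖ := by
      rw [← hprog, norm_mul, Complex.norm_exp_ofReal]
    rw [mul_pow]
    linear_combination ‖ψ p‖ * ‖ψ (p + q₀)‖ * h1 + ‖ψ p‖ * ‖fockKernel (p + q₀)‖ ^ 2 * h2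
  have hN' : IsStarNormal (adjoint B) := by
    have := hN
    exact (inferInstance : IsStarNormal (star B))
  -- Used with `N = B*`, so that `N* N = B B*`.
  obtain ⟨c, hc⟩ := adjoint_apply_apply_eq_smul hN' hnorm
  rw [adjoint_adjoint, adjoint_fockKernel hB, htr0, map_smul] at hc
  have hcz : ∀ z, (starRingEnd ℂ) (ψ p) * (ψ z * Complex.exp (inner ℂ (p + q₀) (L z + q))) =
      c * Complex.exp (inner ℂ p z) := fun z => by
    have := congrArg (fun f : FockSpace d => f z) hc
    simpa only [FockSpace.smul_apply, hB, fockKernel_apply, hφL] using this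
  set s := p - adjoint L p - q₀ with hs
  have hinner : ∀ z, inner ℂ p z = inner ℂ s z + inner ℂ (p + q₀) (L z) := fun z => by
    rw [← adjoint_inner_left, map_add, hLq', hs, ← inner_add_left]
    congr 1
    abel
  have hpne : (starRingEnd ℂ) (ψ p) ≠ 0 := by simpa using hne p
  have hψs : ∀ z, ψ z = ψ 0 * Complex.exp (inner ℂ s z) := fun z => by
    have h1 := hcz z
    have h2 := hcz 0
    rw [map_zero, zero_add, inner_zero_right, Complex.exp_zero, mul_one] at h2
    rw [hinner, inner_add_right, Complex.exp_add, Complex.exp_add, ← h2] at h1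
    refine mul_left_cancel₀ (mul_ne_zero (mul_ne_zero hpne
      (Complex.exp_ne_zero (inner ℂ (p + q₀) (L z))))
      (Complex.exp_ne_zero (inner ℂ (p + q₀) q))) ?_
    linear_combination h1
  refine ⟨L, q, s, p, q₀, hφL, hψs, hqp, rfl, hLq, hLq', fun w => ?_⟩
  have hBK := apply_fockKernel hB hφL hψs
  -- Both sides are now nonzero multiples of kernels, so their base points agree.
  have hcomm := adjoint_apply_apply_comm hN (fockKernel w)
  rw [adjoint_fockKernel hB, hBK, map_smul, map_smul, hBK, adjoint_fockKernel hB, smul_smul,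
    smul_smul, hφL, hφL] at hcomm
  refine (eq_of_smul_exp_inner (s := (starRingEnd ℂ) (ψ w) *
    (ψ 0 * Complex.exp (inner ℂ (L w + q) q)))
    (t := ψ 0 * Complex.exp (inner ℂ w q) * (starRingEnd ℂ) (ψ (adjoint L w + s)))
    ?_ fun z => ?_).2
  · exact mul_ne_zero (by simpa using hne w) (mul_ne_zero (hne 0) (Complex.exp_ne_zero _))
  · exact congrArg (fun f : FockSpace d => f z) hcomm.symm

end Symbols

/-! ## Matrices acting on `ℂᵈ` -/

section Matrices

variable {d : ℕ}

theorem toEuclideanLin_mul_apply (M N : Matrix (Fin d) (Fin d) ℂ) (v : CSpace d) :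
    Matrix.toEuclideanLin (M * N) v = Matrix.toEuclideanLin M (Matrix.toEuclideanLin N v) := by
  simp

theorem toEuclideanLin_one_apply (v : CSpace d) :
    Matrix.toEuclideanLin (1 : Matrix (Fin d) (Fin d) ℂ) v = v := by
  simp

theorem toEuclideanLin_diagonal_apply (μ : Fin d → ℂ) (v : CSpace d) (i : Fin d) :
    Matrix.toEuclideanLin (Matrix.diagonal μ) v i = μ i * v i := by
  simp [Matrix.toLpLin_apply, Matrix.mulVec_diagonal]

theorem inner_toEuclideanLin_left (M : Matrix (Fin d) (Fin d) ℂ) (v w : CSpace d) :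
    inner ℂ (Matrix.toEuclideanLin M v) w =
      inner ℂ v (Matrix.toEuclideanLin M.conjTranspose w) := by
  rw [Matrix.toEuclideanLin_conjTranspose_eq_adjoint, LinearMap.adjoint_inner_right]

theorem conjVec_toEuclideanLin (M : Matrix (Fin d) (Fin d) ℂ) (v : CSpace d) :
    conjVec (Matrix.toEuclideanLin (M.map (starRingEnd ℂ)) v) =
      Matrix.toEuclideanLin M (conjVec v) := by
  ext i
  simp [conjVec, Matrix.toLpLin_apply, Matrix.mulVec, dotProduct]

/-- A unitary matrix as an isometry of `ℂᵈ`. -/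
def unitaryIsometry {V : Matrix (Fin d) (Fin d) ℂ} (hV : V ∈ Matrix.unitaryGroup (Fin d) ℂ) :
    CSpace d ≃ₗᵢ[ℂ] CSpace d where
  toLinearMap := Matrix.toEuclideanLin V
  invFun := Matrix.toEuclideanLin V.conjTranspose
  left_inv v := by
    have h : V.conjTranspose * V = 1 := Matrix.mem_unitaryGroup_iff'.1 hV
    change Matrix.toEuclideanLin V.conjTranspose (Matrix.toEuclideanLin V v) = v
    rw [← toEuclideanLin_mul_apply, h, toEuclideanLin_one_apply]
  right_inv v := by
    have h : V * V.conjTranspose = 1 := Matrix.mem_unitaryGroup_iff.1 hV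
    change Matrix.toEuclideanLin V (Matrix.toEuclideanLin V.conjTranspose v) = v
    rw [← toEuclideanLin_mul_apply, h, toEuclideanLin_one_apply]
  norm_map' v := by
    have h : V.conjTranspose * V = 1 := Matrix.mem_unitaryGroup_iff'.1 hV
    change ‖Matrix.toEuclideanLin V v‖ = ‖v‖
    rw [@norm_eq_sqrt_re_inner ℂ, @norm_eq_sqrt_re_inner ℂ _ _ _ _ v, inner_toEuclideanLin_left,
      ← toEuclideanLin_mul_apply, h, toEuclideanLin_one_apply]

theorem unitaryIsometry_symm_apply {V : Matrix (Fin d) (Fin d) ℂ}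
    (hV : V ∈ Matrix.unitaryGroup (Fin d) ℂ) (v : CSpace d) :
    (unitaryIsometry hV).symm v = Matrix.toEuclideanLin V.conjTranspose v := rfl

/-- Coordinatewise complex conjugation as an antilinear isometry. -/
def conjIsometry (d : ℕ) : CSpace d ≃ₗᵢ⋆[ℂ] CSpace d where
  toFun := conjVec
  map_add' v w := by ext i; simp [conjVec]
  map_smul' c v := by ext i; simp [conjVec]
  invFun := conjVec
  left_inv v := by ext i; simp [conjVec]
  right_inv v := by ext i; simp [conjVec]
  norm_map' v := by simp [EuclideanSpace.norm_eq, conjVec]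

theorem conjVec_conjVec (v : CSpace d) : conjVec (conjVec v) = v := by
  ext i; simp [conjVec]

end Matrices

/-! ## Conjugations of the Fock space induced by antilinear involutions -/

section Involution

variable {d : ℕ}

/-- An antilinear isometry as a real linear isometry. -/
def realIsometry (R : CSpace d ≃ₗᵢ⋆[ℂ] CSpace d) : CSpace d ≃ₗᵢ[ℝ] CSpace d where
  toFun := R
  map_add' := map_add R
  map_smul' c v := by
    have := R.map_smulₛₗ (c : ℂ) v
    simpa using this
  invFun := R.symm
  left_inv := R.symm_apply_apply
  right_inv := R.apply_symm_apply
  norm_map' := R.norm_map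

/-- The antilinear map `f ↦ \overline{f ∘ R}` of the Fock space, where `R` is an antilinear isometry
of `ℂᵈ`. -/
def fockConj (R : CSpace d ≃ₗᵢ⋆[ℂ] CSpace d) : FockSpace d →ₛₗ[starRingEnd ℂ] FockSpace d where
  toFun f := ⟨fun z => (starRingEnd ℂ) (f (R z)), fun z =>
    DifferentiableAt.comp_semilinear₂ (starL ℂ : ℂ ≃L⋆[ℂ] ℂ).toContinuousLinearMap
      (R.toContinuousLinearEquiv : CSpace d →SL[starRingEnd ℂ] CSpace d) (f.differentiable (R z)),
    (f.memLp.comp_measurePreserving (measurePreserving_gaussMeasure (realIsometry R))).star⟩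
  map_add' f g := FockSpace.ext fun z => map_add (starRingEnd ℂ) (f (R z)) (g (R z))
  map_smul' c f := FockSpace.ext fun z => map_mul (starRingEnd ℂ) c (f (R z))

theorem fockConj_apply (R : CSpace d ≃ₗᵢ⋆[ℂ] CSpace d) (f : FockSpace d) (z : CSpace d) :
    fockConj R f z = (starRingEnd ℂ) (f (R z)) := rfl

theorem isConjugation_fockConj {R : CSpace d ≃ₗᵢ⋆[ℂ] CSpace d} (hR : ∀ z, R (R z) = z) :
    IsConjugation (fockConj R) where
  involutive f := FockSpace.ext fun z => by simp [fockConj_apply, hR]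
  isometric f := by
    have h : MeasureTheory.eLpNorm (fockConj R f) 2 (gaussMeasure d) =
        MeasureTheory.eLpNorm f 2 (gaussMeasure d) := by
      rw [← MeasureTheory.eLpNorm_comp_measurePreserving f.memLp.1
        (measurePreserving_gaussMeasure (realIsometry R))]
      refine MeasureTheory.eLpNorm_congr_norm_ae (Filter.Eventually.of_forall fun z => ?_)
      rw [fockConj_apply, RCLike.norm_conj]
      rfl
    rw [FockSpace.eLpNorm_eq, FockSpace.eLpNorm_eq] at h
    exact (ENNReal.ofReal_eq_ofReal_iff (norm_nonneg _) (norm_nonneg _)).1 h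

end Involution

/-! ## Complex selfadjointness -/

section Selfadjoint

-- All domains are the whole space, so only `B = J B* J` is at stake, and it follows from `B J = J
-- B*` and `J² = 1`.
open ContinuousLinearMap in
theorem isConjSelfadjoint_toPMap {H : Type*} [NormedAddCommGroup H] [InnerProductSpace ℂ H]
    [CompleteSpace H] {J : H →ₛₗ[starRingEnd ℂ] H} (hJ : IsConjugation J) {B : H →L[ℂ] H}
    (h : ∀ f, B (J f) = J (adjoint B f)) :
    IsConjSelfadjoint J ((B : H →ₗ[ℂ] H).toPMap ⊤) where
  isClosed := by
    have : ((((B : H →ₗ[ℂ] H).toPMap ⊤).graph : Submodule ℂ (H × H)) : Set (H × H)) =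
        {x | B x.1 = x.2} := by
      ext x
      simp [LinearPMap.mem_graph_iff]
    change IsClosed _
    rw [this]
    exact isClosed_eq (by fun_prop) continuous_snd
  dense := dense_univ
  eq := by
    rw [B.toPMap_adjoint_eq_adjoint_toPMap_of_dense dense_univ]
    refine LinearPMap.ext (by ext; simp [conjugateBy]) fun f hf hg => ?_
    change B f = J (adjoint B (J f))
    rw [← h, hJ.involutive]

-- Evaluating `B* f` at `R z` pairs `f` with `B K_{R z}`, a multiple of the kernel at `L* R z + s =
-- R (L z + q) = R (φ z)`; `hin` identifies the factors.
open ContinuousLinearMap in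
theorem apply_fockConj {d : ℕ} {ψ : CSpace d → ℂ} {φ : CSpace d → CSpace d}
    {B : FockSpace d →L[ℂ] FockSpace d} (hB : ∀ f z, B f z = ψ z * f (φ z))
    {L : CSpace d →L[ℂ] CSpace d} {q s : CSpace d} (hφ : ∀ z, φ z = L z + q)
    (hψ : ∀ z, ψ z = ψ 0 * Complex.exp (inner ℂ s z)) {R : CSpace d ≃ₗᵢ⋆[ℂ] CSpace d}
    (hL : ∀ z, R (L z) = adjoint L (R z)) (hq : R q = s)
    (hin : ∀ z, inner ℂ (R z) q = inner ℂ s z) (f : FockSpace d) :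
    B (fockConj R f) = fockConj R (adjoint B f) := by
  ext z
  rw [hB, fockConj_apply, fockConj_apply, ← inner_fockKernel (R z), adjoint_inner_right,
    apply_fockKernel hB hφ hψ, inner_smul_left, inner_fockKernel, map_mul, Complex.conj_conj, hφ,
    map_add, hL, hq, hin, hψ z]

end Selfadjoint

/-! ## Diagonalization of normal matrices -/

section Diagonalization

open ContinuousLinearMap Module in
/-- A normal operator on a finite dimensional space has an orthonormal basis of eigenvectors. -/
theorem exists_orthonormalBasis_eigenvectors {E : Type*} [NormedAddCommGroup E]
    [InnerProductSpace ℂ E] [FiniteDimensional ℂ E] [CompleteSpace E] {n : ℕ}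
    (hn : finrank ℂ E = n) {L : E →L[ℂ] E} (hL : ∀ z, adjoint L (L z) = L (adjoint L z)) :
    ∃ (b : OrthonormalBasis (Fin n) ℂ E) (μ : Fin n → ℂ), ∀ i, L (b i) = μ i • b i := by
  classical
  -- Up to scaling, the real and imaginary parts of `L`: commuting symmetric operators with `2 L = A
  -- - i B`. Joint eigenvectors are eigenvectors of `L`.
  set A : E →ₗ[ℂ] E := ((L + adjoint L : E →L[ℂ] E) : E →ₗ[ℂ] E) with hA
  set B : E →ₗ[ℂ] E := ((Complex.I • (L - adjoint L) : E →L[ℂ] E) : E →ₗ[ℂ] E) with hB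
  have hAz : ∀ z, A z = L z + adjoint L z := fun z => rfl
  have hBz : ∀ z, B z = Complex.I • (L z - adjoint L z) := fun z => rfl
  have hAs : A.IsSymmetric := fun x y => by
    rw [hAz, hAz, inner_add_left, inner_add_right, adjoint_inner_left, adjoint_inner_right,
      add_comm]
  have hBs : B.IsSymmetric := fun x y => by
    rw [hBz, hBz, inner_smul_left, inner_smul_right, inner_sub_left, inner_sub_right,
      adjoint_inner_left, adjoint_inner_right, Complex.conj_I]
    ring
  have hAB : Commute A B := by
    refine LinearMap.ext fun z => ?_
    change A (B z) = B (A z)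
    simp only [hAz, hBz, map_smul, map_sub, map_add, hL]
    module
  have hint := LinearMap.IsSymmetric.directSum_isInternal_of_commute hAs hBs hAB
  have horth := LinearMap.IsSymmetric.orthogonalFamily_eigenspace_inf_eigenspace hAs hBs
  set W : ℂ × ℂ → Submodule ℂ E := fun i => End.eigenspace A i.2 ⊓ End.eigenspace B i.1 with hW
  have hfin : {i | W i ≠ ⊥}.Finite :=
    WellFoundedGT.finite_ne_bot_of_iSupIndep hint.submodule_iSupIndep
  have : Fintype {i // W i ≠ ⊥} := hfin.fintype
  have hint' := DirectSum.isInternal_ne_bot_iff.2 hint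
  have horth' : OrthogonalFamily ℂ (fun i : {i // W i ≠ ⊥} => W i)
      fun i => (W i).subtypeₗᵢ := horth.comp Subtype.val_injective
  refine ⟨hint'.subordinateOrthonormalBasis hn horth', fun a =>
    (2 : ℂ)⁻¹ * ((hint'.subordinateOrthonormalBasisIndex hn a horth').1.2 -
      Complex.I * (hint'.subordinateOrthonormalBasisIndex hn a horth').1.1), fun a => ?_⟩
  have hmem := hint'.subordinateOrthonormalBasis_subordinate hn a horth'
  set v := hint'.subordinateOrthonormalBasis hn horth' a
  set i := hint'.subordinateOrthonormalBasisIndex hn a horth'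
  have h1 : L v + adjoint L v = i.1.2 • v := End.mem_eigenspace_iff.1 hmem.1
  have h2 : Complex.I • (L v - adjoint L v) = i.1.1 • v := End.mem_eigenspace_iff.1 hmem.2
  have h3 : L v - adjoint L v = -(Complex.I • i.1.1 • v) := by
    rw [← h2, smul_smul, Complex.I_mul_I]
    simp
  have h4 : (2 : ℂ) • L v = i.1.2 • v - Complex.I • i.1.1 • v := by
    rw [← h1, sub_eq_add_neg, ← h3, two_smul]
    abel
  rw [mul_smul, sub_smul, mul_smul, ← h4, smul_smul]
  simp

/-- Every complex number can be rotated onto the real axis. -/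
theorem exists_norm_one_conj_mul_im_eq_zero (a : ℂ) :
    ∃ u : ℂ, ‖u‖ = 1 ∧ ((starRingEnd ℂ) u * a).im = 0 := by
  refine ⟨Complex.exp (a.arg * Complex.I), Complex.norm_exp_ofReal_mul_I _, ?_⟩
  have h : (starRingEnd ℂ) (Complex.exp (a.arg * Complex.I)) * a = (‖a‖ : ℂ) := by
    have h1 := Complex.norm_mul_exp_arg_mul_I a
    have h2 : (starRingEnd ℂ) (Complex.exp (a.arg * Complex.I)) *
        Complex.exp (a.arg * Complex.I) = 1 := by
      rw [mul_comm, Complex.mul_conj, Complex.normSq_eq_norm_sq, Complex.norm_exp_ofReal_mul_I]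
      simp
    calc _ = (starRingEnd ℂ) (Complex.exp (a.arg * Complex.I)) *
          (‖a‖ * Complex.exp (a.arg * Complex.I)) := by rw [h1]
      _ = _ := by rw [mul_left_comm, h2, mul_one]
  rw [h, Complex.ofReal_im]

open ContinuousLinearMap in
/-- A normal operator has a diagonalization adapted to any given vector. -/
theorem exists_isAdaptedDiagonalization {d : ℕ} {L : CSpace d →L[ℂ] CSpace d}
    (hL : ∀ z, adjoint L (L z) = L (adjoint L z)) {Q : Matrix (Fin d) (Fin d) ℂ}
    (hQ : ∀ z, Matrix.toEuclideanLin Q z = L z) (q : CSpace d) :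
    ∃ (V : Matrix (Fin d) (Fin d) ℂ) (μ : Fin d → ℂ), IsAdaptedDiagonalization Q q V μ := by
  obtain ⟨b, μ, hb⟩ := exists_orthonormalBasis_eigenvectors (n := d) (by simp) hL
  -- Multiplying `b i` by a phase `u i` rotates the coordinate of `q` by `conj (u i)`. For `μ i =
  -- 1`, making `i` times the coordinate real makes the coordinate imaginary.
  choose u hu hu' using fun i => exists_norm_one_conj_mul_im_eq_zero
    (if μ i = 1 then Complex.I * inner ℂ (b i) q
      else (1 - (starRingEnd ℂ) (μ i)) * inner ℂ (b i) q)
  set V : Matrix (Fin d) (Fin d) ℂ := Matrix.of fun i j => u j * b j i with hV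
  have hVV : V.conjTranspose * V = 1 := by
    ext i j
    have h1 : (V.conjTranspose * V) i j = inner ℂ (u i • b i) (u j • b j) := by
      rw [Matrix.mul_apply, PiLp.inner_apply]
      refine Finset.sum_congr rfl fun k _ => ?_
      simp [hV]
      ring
    rw [h1, inner_smul_left, inner_smul_right, b.inner_eq_ite, Matrix.one_apply]
    split_ifs with h
    · subst h
      rw [mul_one, mul_comm, Complex.mul_conj, Complex.normSq_eq_norm_sq, hu]
      simp
    · simp
  have hVV' : V * V.conjTranspose = 1 := mul_eq_one_comm.1 hVV
  have hQV : Q * V = V * Matrix.diagonal μ := by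
    ext i j
    have h1 : (Q * V) i j = Matrix.toEuclideanLin Q (u j • b j) i := by
      simp [hV, Matrix.mul_apply, Matrix.toLpLin_apply, Matrix.mulVec, dotProduct,
        Finset.mul_sum, mul_left_comm]
    rw [h1, hQ, map_smul, hb, Matrix.mul_diagonal]
    simp [hV]
    ring
  have hcoord : ∀ i, Matrix.toEuclideanLin V.conjTranspose q i =
      (starRingEnd ℂ) (u i) * inner ℂ (b i) q := fun i => by
    rw [← inner_smul_left, PiLp.inner_apply]
    simp only [Matrix.toLpLin_apply, Matrix.mulVec, dotProduct]
    refine Finset.sum_congr rfl fun k _ => ?_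
    simp [hV]
    ring
  refine ⟨V, μ, Matrix.mem_unitaryGroup_iff.2 hVV', ?_, fun i hi => ?_, fun i hi => ?_⟩
  · rw [← hQV, mul_assoc, hVV', mul_one]
  · have := hu' i
    rw [if_neg hi] at this
    rw [hcoord, mul_left_comm]
    exact this
  · have := hu' i
    rw [if_pos hi, mul_left_comm, Complex.I_mul_im] at this
    rw [hcoord]
    exact this

end Diagonalization

/-! ## The main result -/

/-- The relation between the coordinates `x` of `q` and `y` of `s`, for the symbols `L z + q` and
`e^{⟨z, s⟩}` of a normal weighted composition operator, in an adapted basis of eigenvectors. -/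
theorem eq_conj_of_adapted {m x y p x₀ : ℂ}
    (hx : x = x₀ + (p - m * p)) (hy : y = p - (starRingEnd ℂ) m * p - x₀)
    (h : (starRingEnd ℂ) m * x + y = m * y + x)
    (hre : m ≠ 1 → ((1 - (starRingEnd ℂ) m) * x).im = 0) (him : m = 1 → x.re = 0) :
    (starRingEnd ℂ) x = y := by
  by_cases hm : m = 1
  · subst hm
    -- For `m = 1` the relation `h` is void; only the decomposition through `p` and `x₀` ties `y` to
    -- `x`.
    have h1 : y = -x := by rw [hx, hy]; simp
    rw [h1]
    apply Complex.ext
    · simp [him rfl]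
    · simp
  · have h1 : (1 - m) * y = (1 - (starRingEnd ℂ) m) * x := by linear_combination h
    have h2 := Complex.conj_eq_iff_im.2 (hre hm)
    rw [map_mul, map_sub, map_one, Complex.conj_conj, ← h1] at h2
    exact mul_left_cancel₀ (sub_ne_zero.2 (Ne.symm hm)) h2

end

open ContinuousLinearMap in
theorem proposition2p10 (d : ℕ) (ψ : CSpace d → ℂ) (φ : CSpace d → CSpace d)
    (hψ : Differentiable ℂ ψ) (hψ0 : ψ ≠ 0) (hφ : Differentiable ℂ φ)
    (T : FockSpace d →ₗ.[ℂ] FockSpace d) (hT : IsWeightedComp ψ φ T) (hn : IsBoundedNormal T) :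
    ∃ (Q : Matrix (Fin d) (Fin d) ℂ) (q : CSpace d),
      (∀ z, φ z = Matrix.toEuclideanLin Q z + q) ∧
      (∃ (V : Matrix (Fin d) (Fin d) ℂ) (μ : Fin d → ℂ), IsAdaptedDiagonalization Q q V μ) ∧
      ∀ (V : Matrix (Fin d) (Fin d) ℂ) (μ : Fin d → ℂ), IsAdaptedDiagonalization Q q V μ →
        ∃ J : FockSpace d →ₛₗ[starRingEnd ℂ] FockSpace d,
          IsConjugation J ∧
          (∀ f z, J f z = conjExpr (V.map (starRingEnd ℂ) * V.conjTranspose) 0 1 f z) ∧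
          IsConjSelfadjoint J T := by
  obtain ⟨B, rfl, hN⟩ := hn
  have hB : ∀ f z, B f z = ψ z * f (φ z) := fun f z => by
    have hf := hT.1 (Submodule.mem_top : f ∈ (⊤ : Submodule ℂ (FockSpace d)))
    have := hT.2 (x := ⟨f, Submodule.mem_top⟩) (y := ⟨f, hf⟩) rfl
    exact congrArg (fun g : FockSpace d => g z) this
  obtain ⟨L, q, s, p, q₀, hφL, hψs, hqp, hsp, hLq, hLq', hcomm⟩ :=
    exists_symbols hψ hψ0 hφ hB hN
  -- The constant part of the commutation relation; subtracting it leaves normality of `L`.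
  have hcomm0 : adjoint L q + s = L s + q := by simpa using hcomm 0
  have hnormal : ∀ z, adjoint L (L z) = L (adjoint L z) := fun z => by
    have := hcomm z
    rw [map_add, map_add, add_assoc, add_assoc, hcomm0] at this
    exact add_right_cancel this
  set Q : Matrix (Fin d) (Fin d) ℂ := Matrix.toEuclideanLin.symm (L : CSpace d →ₗ[ℂ] CSpace d)
    with hQdef
  have hQ : ∀ z, Matrix.toEuclideanLin Q z = L z := fun z => by
    rw [hQdef, LinearEquiv.apply_symm_apply]
    rfl
  have hQ' : ∀ z, Matrix.toEuclideanLin Q.conjTranspose z = adjoint L z := fun z =>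
    ext_inner_left ℂ fun w => by
      rw [← inner_toEuclideanLin_left, hQ, adjoint_inner_right]
  refine ⟨Q, q, fun z => by rw [hQ, hφL], exists_isAdaptedDiagonalization hnormal hQ q,
    fun V μ h => ?_⟩
  have hVV : V.conjTranspose * V = 1 := Matrix.mem_unitaryGroup_iff'.1 h.unitary
  set U := unitaryIsometry h.unitary with hU
  have hUL : ∀ z i, U.symm (L z) i = μ i * U.symm z i := fun z i => by
    rw [← hQ, hU, unitaryIsometry_symm_apply, unitaryIsometry_symm_apply,
      ← toEuclideanLin_mul_apply, h.diag, ← mul_assoc, ← mul_assoc, hVV, one_mul,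
      toEuclideanLin_mul_apply, toEuclideanLin_diagonal_apply]
  have hUL' : ∀ z i, U.symm (adjoint L z) i = (starRingEnd ℂ) (μ i) * U.symm z i := fun z i => by
    rw [← hQ', hU, unitaryIsometry_symm_apply, unitaryIsometry_symm_apply,
      ← toEuclideanLin_mul_apply, h.diag, Matrix.conjTranspose_mul, Matrix.conjTranspose_mul,
      Matrix.conjTranspose_conjTranspose, Matrix.diagonal_conjTranspose, ← mul_assoc, hVV, one_mul,
      toEuclideanLin_mul_apply, toEuclideanLin_diagonal_apply]
    rfl
  set R : CSpace d ≃ₗᵢ⋆[ℂ] CSpace d := (U.symm.trans (conjIsometry d)).trans U with hRdef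
  have hR : ∀ z, R z = U (conjVec (U.symm z)) := fun z => rfl
  have hRR : ∀ z, R (R z) = z := fun z => by simp [hR, conjVec_conjVec]
  have hRL : ∀ z, R (L z) = adjoint L (R z) := fun z => by
    refine U.symm.injective ?_
    ext i
    rw [hUL', hR, hR, U.symm_apply_apply, U.symm_apply_apply]
    simp [conjVec, hUL]
  have hRq : R q = s := by
    refine U.symm.injective ?_
    ext i
    rw [hR, U.symm_apply_apply]
    change (starRingEnd ℂ) (U.symm q i) = U.symm s i
    refine eq_conj_of_adapted (m := μ i) (p := U.symm p i) (x₀ := U.symm q₀ i) ?_ ?_ ?_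
      (h.real i) (h.imag i)
    · conv_lhs => rw [hqp]
      simp [hUL]
    · conv_lhs => rw [hsp]
      simp [hUL']
    · have := congrArg (fun v => U.symm v i) hcomm0
      simpa [hUL, hUL'] using this
  -- Symmetry of the conjugation `R`: `⟨q, R z⟩ = ⟨z, R q⟩`, and `R q = s`.
  have hin : ∀ z, inner ℂ (R z) q = inner ℂ s z := fun z => by
    have h1 : inner ℂ (R z) q = inner ℂ (conjVec (U.symm z)) (U.symm q) := by
      rw [hR, ← U.symm.inner_map_map, U.symm_apply_apply]
    have h2 : inner ℂ s z = inner ℂ (conjVec (U.symm q)) (U.symm z) := by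
      rw [← hRq, hR, ← U.symm.inner_map_map, U.symm_apply_apply]
    rw [h1, h2, PiLp.inner_apply, PiLp.inner_apply]
    refine Finset.sum_congr rfl fun i _ => ?_
    simp [conjVec, mul_comm]
  refine ⟨fockConj R, isConjugation_fockConj hRR, fun f z => ?_,
    isConjSelfadjoint_toPMap (isConjugation_fockConj hRR) (apply_fockConj hB hφL hψs hRL hRq hin)⟩
  have h0 : conjVec (0 : CSpace d) = 0 := (conjIsometry d).map_zero
  rw [fockConj_apply, conjExpr, h0, inner_zero_left, Complex.exp_zero, add_zero,
    toEuclideanLin_mul_apply, conjVec_toEuclideanLin, one_mul, one_mul]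
  rfl
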